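/- Let $N\ge 0$ and $m\ge 1$ be integers. For $t=1,\dots,N$ let $m_t\ge 1$, let $D^{(t)}\in\mathbb{R}^{m\times m_t}$ be an arbitrary matrix (for the Wasserstein barycenter problem with prescribed support points $x_1,\dots,x_m$ and weights $\gamma_t$, $D^{(t)}_{ij}=\gamma_t\|x_i-q^{(t)}_j\|_p^p$), and let $a^{(t)}\in\mathbb{R}^{m_t}$ be a probability vector, i.e. $a^{(t)}\ge 0$ and $\sum_j a^{(t)}_j=1$. Write $e_k$ for the all-ones vector of $\mathbb{R}^k$, $\Delta_m=\{w\in\mathbb{R}^m: w\ge 0,\ e_m^\top w=1\}$, $\delta_{\Delta_m}$ for its indicator function, $\delta^*_{\Delta_m}(u)=\sup_{x}\{\langle u,x\rangle-\delta_{\Delta_m}(x)\}$ for its conjugate, and $\delta^t_+$ for the indicator function of the entrywise nonnegative matrices in $\mathbb{R}^{m\times m_t}$. Consider the primal barycenter problem $$\min_{w,\{\Pi^{(t)}\}}\ \delta_{\Delta_m}(w)+\sum_{t=1}^N\delta^t_+(\Pi^{(t)})+\sum_{t=1}^N\langle D^{(t)},\Pi^{(t)}\rangle\quad\text{s.t.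 } \Pi^{(t)}e_{m_t}=w,\ (\Pi^{(t)})^\top e_m=a^{(t)},\ t=1,\dots,N,\tag{P}$$ and the dual problem $$\min_{u,\{V^{(t)}\},\{y^{(t)}\},\{z^{(t)}\}}\ \delta^*_{\Delta_m}(u)+\sum_{t=1}^N\delta^t_+(V^{(t)})+\sum_{t=1}^N\langle z^{(t)},a^{(t)}\rangle\quad\text{s.t. } \sum_{t=1}^N y^{(t)}-u=0,\ V^{(t)}-D^{(t)}-y^{(t)}e_{m_t}^\top-e_m(z^{(t)})^\top=0,\ t=1,\dots,N.\tag{D}$$ For $\beta>0$ let $$\mathcal L_\beta(u,V,y,z;\lambda,\Lambda)=\delta^*_{\Delta_m}(u)+\sum_t\delta^t_+(V^{(t)})+\sum_t\langle z^{(t)},a^{(t)}\rangle+\langle\lambda,r\rangle+\sum_t\langle\Lambda^{(t)},R^{(t)}\rangle+\tfrac{\beta}{2}\|r\|^2+\tfrac{\beta}{2}\sum_t\|R^{(t)}\|_F^2,$$ where $r=\sum_t y^{(t)}-u$ and $R^{(t)}=V^{(t)}-D^{(t)}-y^{(t)}e_{m_t}^\top-e_m(z^{(t)})^\top$. Let $\tau\in(0,\frac{1+\sqrt5}{2})$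 and let $(u^k,V^k,y^k,z^k,\lambda^k,\Lambda^k)_{k\ge0}$ be generated from an arbitrary starting point with $V^{(t),0}\ge0$ for all $t$ by the sGS-ADMM iteration $$\begin{aligned} (u^{k+1},V^{k+1})&\in\arg\min_{u,V}\mathcal L_\beta(u,V,y^k,z^k;\lambda^k,\Lambda^k),\\ \tilde z^{k+1}&\in\arg\min_{z}\mathcal L_\beta(u^{k+1},V^{k+1},y^k,z;\lambda^k,\Lambda^k),\\ y^{k+1}&\in\arg\min_{y}\mathcal L_\beta(u^{k+1},V^{k+1},y,\tilde z^{k+1};\lambda^k,\Lambda^k),\\ z^{k+1}&\in\arg\min_{z}\mathcal L_\beta(u^{k+1},V^{k+1},y^{k+1},z;\lambda^k,\Lambda^k),\\ \lambda^{k+1}&=\lambda^k+\tau\beta\Big(\sum_t y^{(t),k+1}-u^{k+1}\Big),\\ \Lambda^{(t),k+1}&=\Lambda^{(t),k}+\tau\beta\big(V^{(t),k+1}-D^{(t)}-y^{(t),k+1}e_{m_t}^\top-e_m(z^{(t),k+1})^\top\big),\quad t=1,\dots,N. \end{aligned}$$ Then the sequence $(u^k,V^k,y^k,z^k)$ converges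 to an optimal solution of (D), and the sequence $(\lambda^k,\Lambda^k)$ converges to an optimal solution of (P). -/

import Mathlib

open Filter Topology

namespace WassersteinBarycenter

/-- The indicator function `δ_S` of convex analysis: `0` on `S` and `+∞` outside `S`. -/
noncomputable def indicatorFn {E : Type*} (S : Set E) (x : E) : EReal :=
  open Classical in if x ∈ S then 0 else ⊤

/-- The convex conjugate `f*(y) = sup_x (⟨y, x⟩ - f x)` of an extended-real-valued function
on `ℝ^m`. -/
noncomputable def conjugate {m : ℕ} (f : (Fin m → ℝ) → EReal) (y : Fin m → ℝ) : EReal :=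
  ⨆ x : Fin m → ℝ, ((y ⬝ᵥ x : ℝ) : EReal) - f x

/-- The Frobenius inner product of two real matrices. -/
def frobInner {m k : ℕ} (A B : Matrix (Fin m) (Fin k) ℝ) : ℝ :=
  ∑ i, ∑ j, A i j * B i j

/-- The set of entrywise nonnegative matrices. -/
def nonnegMatrices (m k : ℕ) : Set (Matrix (Fin m) (Fin k) ℝ) :=
  {P | ∀ i j, 0 ≤ P i j}

/-- Families `(y⁽¹⁾, …, y⁽ᴺ⁾)` of vectors of `ℝ^m`. -/
abbrev YFam (N m : ℕ) : Type := Fin N → Fin m → ℝ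

/-- Families `(z⁽¹⁾, …, z⁽ᴺ⁾)` of vectors with `z⁽ᵗ⁾ ∈ ℝ^{m_t}`; here `n t` is `m_t`. -/
abbrev ZFam {N : ℕ} (n : Fin N → ℕ) : Type := (t : Fin N) → Fin (n t) → ℝ

/-- Families of matrices, the `t`-th one being of size `m × m_t`. -/
abbrev MatFam {N : ℕ} (m : ℕ) (n : Fin N → ℕ) : Type :=
  (t : Fin N) → Matrix (Fin m) (Fin (n t)) ℝ

variable {N m : ℕ} {n : Fin N → ℕ}

/-- `x` is an optimal solution of `min F` subject to the constraint set `C`: it is feasible,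
has a finite objective value, and minimizes `F` over `C`. -/
def IsOptimalSolution {E : Type*} (F : E → EReal) (C : Set E) (x : E) : Prop :=
  x ∈ C ∧ F x < ⊤ ∧ IsMinOn F C x

/-! ### The primal linear program -/

/-- Objective `δ_Δ(w) + ∑ₜ δ₊(Π⁽ᵗ⁾) + ∑ₜ ⟨D⁽ᵗ⁾, Π⁽ᵗ⁾⟩`, where `Δ` is the unit simplex. -/
noncomputable def primalObjective (D : MatFam m n) (p : (Fin m → ℝ) × MatFam m n) : EReal :=
  indicatorFn (stdSimplex ℝ (Fin m)) p.1
    + ∑ t, indicatorFn (nonnegMatrices m (n t)) (p.2 t)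
    + ((∑ t, frobInner (D t) (p.2 t) : ℝ) : EReal)

/-- Constraints `Π⁽ᵗ⁾ e = w` and `(Π⁽ᵗ⁾)ᵀ e = a⁽ᵗ⁾` for all `t`. -/
def primalConstraints (a : ZFam n) : Set ((Fin m → ℝ) × MatFam m n) :=
  {p | ∀ t, (p.2 t).mulVec 1 = p.1 ∧ (p.2 t).transpose.mulVec 1 = a t}

/-- `(w, {Π⁽ᵗ⁾})` is an optimal solution of the primal barycenter problem. -/
def IsPrimalOptimal (a : ZFam n) (D : MatFam m n) (w : Fin m → ℝ) (P : MatFam m n) : Prop :=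
  IsOptimalSolution (primalObjective D) (primalConstraints a) (w, P)

/-! ### The dual problem -/

/-- `∑ₜ y⁽ᵗ⁾ - u`. -/
def residualU (u : Fin m → ℝ) (y : YFam N m) : Fin m → ℝ :=
  (∑ t, y t) - u

/-- `V⁽ᵗ⁾ - D⁽ᵗ⁾ - y⁽ᵗ⁾ eᵀ - e (z⁽ᵗ⁾)ᵀ`. -/
def residualV (D V : MatFam m n) (y : YFam N m) (z : ZFam n) : MatFam m n :=
  fun t => V t - D t - Matrix.vecMulVec (y t) 1 - Matrix.vecMulVec 1 (z t)

/-- Objective `δ_Δ*(u) + ∑ₜ δ₊(V⁽ᵗ⁾) + ∑ₜ ⟨z⁽ᵗ⁾, a⁽ᵗ⁾⟩` of the dual problem. -/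
noncomputable def dualObjective (a : ZFam n) (u : Fin m → ℝ) (V : MatFam m n) (z : ZFam n) :
    EReal :=
  conjugate (indicatorFn (stdSimplex ℝ (Fin m))) u
    + ∑ t, indicatorFn (nonnegMatrices m (n t)) (V t)
    + ((∑ t, z t ⬝ᵥ a t : ℝ) : EReal)

/-- Constraints of the dual problem: both residuals vanish. -/
def dualConstraints (D : MatFam m n) : Set ((Fin m → ℝ) × MatFam m n × YFam N m × ZFam n) :=
  {q | residualU q.1 q.2.2.1 = 0 ∧ residualV D q.2.1 q.2.2.1 q.2.2.2 = 0}

/-- `(u, {V⁽ᵗ⁾}, {y⁽ᵗ⁾}, {z⁽ᵗ⁾})` is an optimal solution of the dual problem. -/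
def IsDualOptimal (a : ZFam n) (D : MatFam m n) (u : Fin m → ℝ) (V : MatFam m n)
    (y : YFam N m) (z : ZFam n) : Prop :=
  IsOptimalSolution (fun q => dualObjective a q.1 q.2.1 q.2.2.2) (dualConstraints D) (u, V, y, z)

/-- The Lagrangian of the dual problem, with multipliers `lam` and `Lam`. -/
noncomputable def lagrangian (a : ZFam n) (D : MatFam m n) (u : Fin m → ℝ) (V : MatFam m n)
    (y : YFam N m) (z : ZFam n) (lam : Fin m → ℝ) (Lam : MatFam m n) : EReal :=
  dualObjective a u V z
    + ((lam ⬝ᵥ residualU u y + ∑ t, frobInner (Lam t) (residualV D V y z t) : ℝ) : EReal)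

/-- The augmented Lagrangian `L_β` of the dual problem. -/
noncomputable def augLagrangian (a : ZFam n) (D : MatFam m n) (β : ℝ) (u : Fin m → ℝ)
    (V : MatFam m n) (y : YFam N m) (z : ZFam n) (lam : Fin m → ℝ) (Lam : MatFam m n) : EReal :=
  lagrangian a D u V y z lam Lam
    + ((β / 2 * (residualU u y ⬝ᵥ residualU u y)
        + β / 2 * ∑ t, frobInner (residualV D V y z t) (residualV D V y z t) : ℝ) : EReal)

/-- The sequences `(u^k, V^k, y^k, z^k, λ^k, Λ^k)`, with the intermediate vectors `ztil (k+1)`,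
are generated by the symmetric Gauss-Seidel based ADMM with penalty parameter `β` and dual
step size `τ`. -/
structure IsSGSADMM (a : ZFam n) (D : MatFam m n) (β τ : ℝ)
    (u : ℕ → Fin m → ℝ) (V : ℕ → MatFam m n) (y : ℕ → YFam N m) (ztil z : ℕ → ZFam n)
    (lam : ℕ → Fin m → ℝ) (Lam : ℕ → MatFam m n) : Prop where
  init : ∀ t, V 0 t ∈ nonnegMatrices m (n t)
  step1 : ∀ k, IsMinOn
    (fun q : (Fin m → ℝ) × MatFam m n =>
      augLagrangian a D β q.1 q.2 (y k) (z k) (lam k) (Lam k))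
    Set.univ (u (k + 1), V (k + 1))
  step2a : ∀ k, IsMinOn
    (fun z' : ZFam n =>
      augLagrangian a D β (u (k + 1)) (V (k + 1)) (y k) z' (lam k) (Lam k))
    Set.univ (ztil (k + 1))
  step2b : ∀ k, IsMinOn
    (fun y' : YFam N m =>
      augLagrangian a D β (u (k + 1)) (V (k + 1)) y' (ztil (k + 1)) (lam k) (Lam k))
    Set.univ (y (k + 1))
  step2c : ∀ k, IsMinOn
    (fun z' : ZFam n =>
      augLagrangian a D β (u (k + 1)) (V (k + 1)) (y (k + 1)) z' (lam k) (Lam k))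
    Set.univ (z (k + 1))
  step3_lam : ∀ k,
    lam (k + 1) = lam k + (τ * β) • residualU (u (k + 1)) (y (k + 1))
  step3_Lam : ∀ k t,
    Lam (k + 1) t = Lam k t + (τ * β) • residualV D (V (k + 1)) (y (k + 1)) (z (k + 1)) t

end WassersteinBarycenter

open WassersteinBarycenter

/-!
The iteration is a semi-proximal ADMM in disguise. Put `x = (-u, V)` and `w = (y, z)`; then the
dual problem reads `min f x + b w` subject to `x + B w = c`, with `f` convex and `b` linear.
Eliminating the intermediate vectors `ztil` from the sweep `z, y, z` (`sweep_condition`) gives the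
first order condition of one joint minimization over `w` with the extra proximal term
`β / 2 * T (Δw, Δw)`, where `T` is the explicit positive semidefinite form `sweepTerm`. The form
`⟨B w, B w⟩` is degenerate for `N ≥ 2`, as constants can be moved between `y⁽ᵗ⁾` and `z⁽ᵗ⁾`, but
`⟨B w, B w⟩ + T (w, w)` is positive definite (`eq_zero_of_pairing_add_sweepTerm`); this is why the
whole sequence converges although dual solutions are not unique.

Convergence is proved for an abstract `SplitProblem`. Relative to a Karush-Kuhn-Tucker point, the
`potential`, a weighted sum of the squared distance to that point, the squared last increment and
the squared last residual, decreases (`SplitProblem.potential_step`): monotonicity of `∂f` gives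
this up to the cross term `⟨B Δw, r⟩`, which the optimality conditions of two consecutive steps move back to the previous
residual, and which can be absorbed precisely when `(1 - τ)² < 2 - τ`, that is, when `τ` is below
the golden ratio. Hence residuals and increments vanish, every cluster point is a
Karush-Kuhn-Tucker point, and the potential relative to a cluster point tends to zero
(`SplitProblem.IsADMM.exists_tendsto`).

A Karush-Kuhn-Tucker point is an optimal pair (`isDualOptimal_of_isKKT`,
`isPrimalOptimal_of_isKKT`). Such a point exists (`exists_isKKT`): the primal problem has a solution
by compactness; separating the image of the polytope of relaxed plans from a point just below the
optimal value gives approximate multipliers `y` of the coupling constraint `Λ⁽ᵗ⁾ e = λ`; after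
normalization these are bounded, and a limit of them, completed by the best `z`, is a dual solution.
-/

/-! ### Positive definite homogeneous functions -/

section CoerciveForms

variable {W : Type*} [AddCommGroup W] [Module ℝ W] [TopologicalSpace W] [IsTopologicalAddGroup W]
  [ContinuousSMul ℝ W] [T2Space W] [FiniteDimensional ℝ W]

/-- A positive definite 2-homogeneous continuous function dominates a squared norm: its minimum over
the unit sphere is positive. -/
theorem exists_pos_mul_norm_sq_le {q : W → ℝ} (hc : Continuous q)
    (h2 : ∀ (s : ℝ) w, q (s • w) = s ^ 2 * q w) (hpos : ∀ w, w ≠ 0 → 0 < q w) :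
    ∃ c > 0, ∀ w, c * ‖toEuclidean w‖ ^ 2 ≤ q w := by
  have hq0 : q 0 = 0 := by simpa using h2 0 0
  rcases (Metric.sphere (0 : EuclideanSpace ℝ (Fin (Module.finrank ℝ W))) 1).eq_empty_or_nonempty
    with hS | hS
  · refine ⟨1, one_pos, fun w => ?_⟩
    have hw : toEuclidean w = 0 := by
      by_contra hne
      have : (‖toEuclidean w‖⁻¹ : ℝ) • toEuclidean w ∈ Metric.sphere 0 1 := by
        simp [norm_smul, hne]
      rw [hS] at this
      exact this
    have hw' : w = 0 := by simpa using hw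
    simp [hw', hq0]
  · obtain ⟨v, hv, hmin⟩ := (isCompact_sphere _ _).exists_isMinOn hS
      (hc.comp toEuclidean.symm.continuous).continuousOn
    have hv1 : ‖v‖ = 1 := by simpa using hv
    have hv0 : toEuclidean.symm v ≠ (0 : W) := by
      intro h
      have : v = 0 := by simpa using h
      simp [this] at hv1
    refine ⟨q (toEuclidean.symm v), hpos _ hv0, fun w => ?_⟩
    by_cases hw : w = 0
    · simp [hw, hq0]
    have hn : toEuclidean w ≠ 0 := by simpa using hw
    have hmem : (‖toEuclidean w‖⁻¹ : ℝ) • toEuclidean w ∈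
        Metric.sphere (0 : EuclideanSpace ℝ (Fin (Module.finrank ℝ W))) 1 := by
      simp [norm_smul, hn]
    have := hmin hmem
    simp only [Function.comp, Set.mem_ofPred_eq, map_smul,
      ContinuousLinearEquiv.symm_apply_apply, h2] at this
    have hp : 0 < ‖toEuclidean w‖ := norm_pos_iff.2 hn
    calc _ ≤ ((‖toEuclidean w‖⁻¹) ^ 2 * q w) * ‖toEuclidean w‖ ^ 2 := by gcongr
      _ = q w := by field_simp

/-- A positive definite 2-homogeneous function controls convergence to a point. -/
theorem tendsto_of_tendsto_form {q : W → ℝ} (hc : Continuous q)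
    (h2 : ∀ (s : ℝ) w, q (s • w) = s ^ 2 * q w) (hpos : ∀ w, w ≠ 0 → 0 < q w)
    {w : ℕ → W} {w₀ : W} (h : Tendsto (fun k => q (w k - w₀)) atTop (𝓝 0)) :
    Tendsto w atTop (𝓝 w₀) := by
  obtain ⟨c, hc0, hle⟩ := exists_pos_mul_norm_sq_le hc h2 hpos
  have h1 : Tendsto (fun k => ‖toEuclidean (w k - w₀)‖ ^ 2) atTop (𝓝 0) := by
    refine squeeze_zero (fun k => by positivity) (fun k => ?_) (by simpa using h.const_mul c⁻¹)
    rw [← div_eq_inv_mul, le_div_iff₀ hc0, mul_comm]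
    exact hle _
  have h3 : Tendsto (fun k => toEuclidean (w k - w₀)) atTop (𝓝 0) := by
    rw [tendsto_zero_iff_norm_tendsto_zero]
    have := h1.sqrt
    simpa [Real.sqrt_sq] using this
  have h4 := (toEuclidean (E := W)).symm.continuous.continuousAt.tendsto.comp h3
  have h5 : Tendsto (fun k => w k - w₀) atTop (𝓝 0) := by simpa [Function.comp_def] using h4
  simpa using h5.add_const w₀

/-- Sublevel sets of a positive definite 2-homogeneous function are relatively compact. -/
theorem exists_tendsto_subseq_of_form_le {q : W → ℝ} (hc : Continuous q)
    (h2 : ∀ (s : ℝ) w, q (s • w) = s ^ 2 * q w) (hpos : ∀ w, w ≠ 0 → 0 < q w)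
    {w : ℕ → W} {w₀ : W} {M : ℝ} (h : ∀ k, q (w k - w₀) ≤ M) :
    ∃ w', ∃ φ : ℕ → ℕ, StrictMono φ ∧ Tendsto (fun j => w (φ j)) atTop (𝓝 w') := by
  obtain ⟨c, hc0, hle⟩ := exists_pos_mul_norm_sq_le hc h2 hpos
  have hb : ∀ k, toEuclidean (w k - w₀) ∈
      Metric.closedBall (0 : EuclideanSpace ℝ (Fin (Module.finrank ℝ W))) (√(M / c)) := by
    intro k
    rw [mem_closedBall_zero_iff]
    apply Real.le_sqrt_of_sq_le
    rw [le_div_iff₀ hc0, mul_comm]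
    exact (hle _).trans (h k)
  obtain ⟨v, -, φ, hφ, hv⟩ := tendsto_subseq_of_bounded Metric.isBounded_closedBall hb
  refine ⟨toEuclidean.symm v + w₀, φ, hφ, ?_⟩
  have h4 := ((toEuclidean (E := W)).symm.continuous.continuousAt.tendsto.comp hv).add_const w₀
  simpa [Function.comp_def] using h4

end CoerciveForms

/-! ### Semi-proximal ADMM with a linear second block -/

/-- Data of a convex problem `min f x + b y` subject to `x + B y = c` in which the second block
enters linearly. Instead of `f`, only the relation `K x L`, standing for `-L ∈ ∂f x`, is recorded.
The form `p` is the inner product of the constraint space and `T` is the proximal term attached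
to the second block; only `⟨B y, B y⟩ + T (y, y)` has to be positive definite. -/
structure SplitProblem (E Y : Type*) [AddCommGroup E] [Module ℝ E] [TopologicalSpace E]
    [AddCommGroup Y] [Module ℝ Y] [TopologicalSpace Y] where
  p : E →ₗ[ℝ] E →ₗ[ℝ] ℝ
  T : Y →ₗ[ℝ] Y →ₗ[ℝ] ℝ
  B : Y →ₗ[ℝ] E
  b : Y →ₗ[ℝ] ℝ
  c : E
  K : E → E → Prop
  p_symm : ∀ x x', p x x' = p x' x
  p_pos : ∀ x, x ≠ 0 → 0 < p x x
  p_cont : Continuous fun w : E × E => p w.1 w.2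
  T_symm : ∀ y y', T y y' = T y' y
  T_nonneg : ∀ y, 0 ≤ T y y
  T_cont : Continuous fun w : Y × Y => T w.1 w.2
  nondegenerate : ∀ y, p (B y) (B y) + T y y = 0 → y = 0
  K_closed : IsClosed {w : E × E | K w.1 w.2}
  K_anti : ∀ {x L x' L'}, K x L → K x' L' → p (L - L') (x - x') ≤ 0

namespace SplitProblem

variable {E Y : Type*} [AddCommGroup E] [Module ℝ E] [TopologicalSpace E]
  [AddCommGroup Y] [Module ℝ Y] [TopologicalSpace Y] (S : SplitProblem E Y)

/-- The Karush-Kuhn-Tucker conditions, with multiplier `L`. -/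
def IsKKT (x : E) (y : Y) (L : E) : Prop :=
  S.K x L ∧ (∀ y', S.b y' + S.p L (S.B y') = 0) ∧ x + S.B y = S.c

/-- The residual `x + B y - c` of the linear constraint. -/
def res (x : E) (y : Y) : E := x + S.B y - S.c

/-- Semi-proximal ADMM with penalty `β` and step length `τ`, each minimization being replaced by
its first order optimality condition. -/
structure IsADMM (β τ : ℝ) (x : ℕ → E) (y : ℕ → Y) (L : ℕ → E) : Prop where
  step_x : ∀ k, S.K (x (k + 1)) (L k + β • S.res (x (k + 1)) (y k))
  step_y : ∀ k y', S.b y' + S.p (L k + β • S.res (x (k + 1)) (y (k + 1))) (S.B y')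
    + β * S.T (y (k + 1) - y k) y' = 0
  step_L : ∀ k, L (k + 1) = L k + (τ * β) • S.res (x (k + 1)) (y (k + 1))

/-- The weighted squared distance of `(y, L)` in which the iterates are nearly Fejér monotone. -/
noncomputable def energy (β τ : ℝ) (w : Y × E) : ℝ :=
  (τ * β ^ 2)⁻¹ * S.p w.2 w.2 + S.p (S.B w.1) (S.B w.1) + S.T w.1 w.1

/-- The Lyapunov function of the method at step `k + 1`, relative to the point `w`. -/
noncomputable def potential (β τ σ : ℝ) (x : ℕ → E) (y : ℕ → Y) (L : ℕ → E) (w : Y × E) (k : ℕ) :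
    ℝ :=
  S.energy β τ ((y (k + 1), L (k + 1)) - w) + S.T (y (k + 1) - y k) (y (k + 1) - y k)
    + σ * S.p (S.res (x (k + 1)) (y (k + 1))) (S.res (x (k + 1)) (y (k + 1)))

variable {S}

theorem p_nonneg (x : E) : 0 ≤ S.p x x := by
  by_cases h : x = 0
  · simp [h]
  · exact (S.p_pos x h).le

theorem energy_nonneg {β τ : ℝ} (hτ : 0 < τ) (w : Y × E) : 0 ≤ S.energy β τ w := by
  have h1 := S.p_nonneg w.2
  have h2 := S.p_nonneg (S.B w.1)
  have h3 := S.T_nonneg w.1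
  unfold energy
  positivity

theorem energy_pos {β τ : ℝ} (hβ : 0 < β) (hτ : 0 < τ) (w : Y × E) (hw : w ≠ 0) :
    0 < S.energy β τ w := by
  have h1 := S.p_nonneg w.2
  have h2 := S.p_nonneg (S.B w.1)
  have h3 := S.T_nonneg w.1
  have hc : 0 < (τ * β ^ 2)⁻¹ := by positivity
  unfold energy
  by_cases h : w.2 = 0
  · have h4 : w.1 ≠ 0 := fun h' => hw (Prod.ext h' h)
    have h5 : S.p (S.B w.1) (S.B w.1) + S.T w.1 w.1 ≠ 0 := fun h' => h4 (S.nondegenerate _ h')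
    have : 0 < S.p (S.B w.1) (S.B w.1) + S.T w.1 w.1 := lt_of_le_of_ne (by positivity) h5.symm
    have : 0 ≤ (τ * β ^ 2)⁻¹ * S.p w.2 w.2 := by positivity
    linarith
  · have := mul_pos hc (S.p_pos _ h)
    linarith

theorem energy_smul {β τ : ℝ} (s : ℝ) (w : Y × E) :
    S.energy β τ (s • w) = s ^ 2 * S.energy β τ w := by
  simp only [energy, Prod.smul_fst, Prod.smul_snd, map_smul, LinearMap.smul_apply, smul_eq_mul]
  ring

/-- One step of the method decreases the energy, up to the cross term `⟨B Δy, r⟩`. -/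
theorem energy_step {β τ : ℝ} (hβ : 0 < β) (hτ : 0 < τ) {x : ℕ → E} {y : ℕ → Y} {L : ℕ → E}
    (h : S.IsADMM β τ x y L) {xs : E} {ys : Y} {Ls : E} (hs : S.IsKKT xs ys Ls) (k : ℕ) :
    S.energy β τ ((y (k + 1), L (k + 1)) - (ys, Ls))
      + (2 - τ) * S.p (S.res (x (k + 1)) (y (k + 1))) (S.res (x (k + 1)) (y (k + 1)))
      + S.p (S.B (y (k + 1) - y k)) (S.B (y (k + 1) - y k))
      + S.T (y (k + 1) - y k) (y (k + 1) - y k)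
      - 2 * S.p (S.B (y (k + 1) - y k)) (S.res (x (k + 1)) (y (k + 1)))
      ≤ S.energy β τ ((y k, L k) - (ys, Ls)) := by
  obtain ⟨hK, hb, hc⟩ := hs
  set d := y (k + 1) - y k with hd
  set r := S.res (x (k + 1)) (y (k + 1)) with hr
  set e := y (k + 1) - ys with he
  set l := L k - Ls with hl
  have hrk : S.res (x (k + 1)) (y k) = r - S.B d := by
    simp only [hr, hd, res, map_sub]; abel
  have hxe : x (k + 1) - xs = r - S.B e := by
    rw [hr, he, res, ← hc, map_sub]; abel
  have hmono := S.K_anti (h.step_x k) hK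
  have e1 : L k + β • S.res (x (k + 1)) (y k) - Ls = l + β • r - β • S.B d := by
    rw [hrk, hl, smul_sub]; abel
  rw [e1, hxe] at hmono
  have hy := h.step_y k e
  have hyb := hb e
  rw [← hr, ← hd] at hy
  have e2 : S.p (l + β • r) (S.B e) + β * S.T d e = 0 := by
    rw [hl]
    simp only [map_add, map_sub, LinearMap.add_apply, LinearMap.sub_apply] at hy ⊢
    linarith
  have e3 : (y (k + 1), L (k + 1)) - (ys, Ls) = (e, l + (τ * β) • r) := by
    rw [h.step_L k, ← hr, he, hl]; ext1
    · simp
    · simp; abel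
  have e4 : (y k, L k) - (ys, Ls) = (e - d, l) := by
    rw [he, hd, hl]; ext1
    · simp
    · simp
  rw [e3, e4]
  simp only [energy, map_add, map_sub, map_smul, LinearMap.add_apply, LinearMap.sub_apply,
    LinearMap.smul_apply, smul_eq_mul] at hmono e2 ⊢
  rw [S.p_symm r l, S.p_symm (S.B d) (S.B e), S.T_symm d e] at *
  have hcross : (τ * β ^ 2)⁻¹ * (S.p l l + τ * β * S.p l r
        + (τ * β * S.p l r + τ * β * (τ * β * S.p r r)))
      = (τ * β ^ 2)⁻¹ * S.p l l + 2 * (S.p l r / β) + τ * S.p r r := by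
    field_simp; ring
  have hdiv : S.p l r / β + S.p r r - S.p (S.B d) r + S.p (S.B e) (S.B d) + S.T e d ≤ 0 := by
    have : β * (S.p l r / β + S.p r r - S.p (S.B d) r + S.p (S.B e) (S.B d) + S.T e d)
        = S.p l r + β * S.p r r - β * S.p (S.B d) r + β * S.p (S.B e) (S.B d)
          + β * S.T e d := by field_simp
    by_contra hcon
    have := mul_pos hβ (not_le.1 hcon)
    nlinarith
  nlinarith

/-- Comparing the second block conditions at two consecutive steps controls the cross term. -/
theorem cross_le {β τ : ℝ} (hβ : 0 < β) {x : ℕ → E} {y : ℕ → Y} {L : ℕ → E}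
    (h : S.IsADMM β τ x y L) (k : ℕ) :
    2 * S.p (S.B (y (k + 2) - y (k + 1))) (S.res (x (k + 2)) (y (k + 2)))
      + S.T (y (k + 2) - y (k + 1)) (y (k + 2) - y (k + 1))
      ≤ 2 * (1 - τ) * S.p (S.B (y (k + 2) - y (k + 1))) (S.res (x (k + 1)) (y (k + 1)))
      + S.T (y (k + 1) - y k) (y (k + 1) - y k) := by
  have h1 := h.step_y (k + 1) (y (k + 2) - y (k + 1))
  have h0 := h.step_y k (y (k + 2) - y (k + 1))
  rw [h.step_L k] at h1
  set d' := y (k + 2) - y (k + 1)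
  set d := y (k + 1) - y k
  set r := S.res (x (k + 1)) (y (k + 1))
  change S.b d' + S.p (L k + (τ * β) • r + β • S.res (x (k + 2)) (y (k + 2))) (S.B d')
    + β * S.T d' d' = 0 at h1
  set r' := S.res (x (k + 2)) (y (k + 2))
  simp only [map_add, map_smul, LinearMap.add_apply, LinearMap.smul_apply, smul_eq_mul] at h0 h1
  have hT := S.T_nonneg (d' - d)
  simp only [map_sub, LinearMap.sub_apply] at hT
  rw [S.T_symm d' d] at hT
  rw [S.p_symm (S.B d') r', S.p_symm (S.B d') r]
  have key : S.p r' (S.B d') = (1 - τ) * S.p r (S.B d') - S.T d' d' + S.T d d' := by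
    have : β * (S.p r' (S.B d') - ((1 - τ) * S.p r (S.B d') - S.T d' d' + S.T d d')) = 0 := by
      linarith
    rcases mul_eq_zero.1 this with h | h
    · exact absurd h hβ.ne'
    · linarith
  rw [key]
  linarith

/-- The golden ratio is exactly the bound on the step length that leaves room for the weights
used to split the cross term. -/
theorem exists_weights {τ : ℝ} (hτ : τ ∈ Set.Ioo (0 : ℝ) ((1 + √5) / 2)) :
    ∃ A σ : ℝ, 0 < A ∧ A < 1 ∧ 0 ≤ σ ∧ σ < 2 - τ ∧ A * σ = (1 - τ) ^ 2 := by
  obtain ⟨h0, h1⟩ := hτ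
  have h5 : √5 ^ 2 = 5 := Real.sq_sqrt (by norm_num)
  have h5' : √5 < 3 := by
    rw [Real.sqrt_lt' (by norm_num)]; norm_num
  have hτ2 : 0 < 2 - τ := by linarith
  have hgold : (1 - τ) ^ 2 < 2 - τ := by
    have h6 : 1 < √5 := by
      rw [Real.lt_sqrt (by norm_num)]; norm_num
    have h7 : 0 < τ - (1 - √5) / 2 := by linarith
    nlinarith [mul_pos (sub_pos.2 h1) h7]
  have hq : (1 - τ) ^ 2 / (2 - τ) < 1 := by rwa [div_lt_one hτ2]
  have hq0 : 0 ≤ (1 - τ) ^ 2 / (2 - τ) := by positivity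
  set A := ((1 - τ) ^ 2 / (2 - τ) + 1) / 2 with hA
  have hA0 : 0 < A := by linarith
  refine ⟨A, (1 - τ) ^ 2 / A, hA0, by linarith, by positivity, ?_, by field_simp⟩
  rw [div_lt_iff₀ hA0]
  have : (1 - τ) ^ 2 / (2 - τ) < A := by linarith
  rw [div_lt_iff₀ hτ2] at this
  linarith

/-- The square of `A v - (1 - τ) r` is nonnegative. -/
theorem cross_split {τ A σ : ℝ} (hA : 0 < A) (hσ : A * σ = (1 - τ) ^ 2) (v r : E) :
    2 * (1 - τ) * S.p v r ≤ A * S.p v v + σ * S.p r r := by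
  have h := S.p_nonneg (A • v - (1 - τ) • r)
  simp only [map_sub, map_smul, LinearMap.sub_apply, LinearMap.smul_apply, smul_eq_mul] at h
  rw [S.p_symm r v] at h
  have : 0 ≤ A * (A * S.p v v + σ * S.p r r - 2 * (1 - τ) * S.p v r) := by
    have e : A * (σ * S.p r r) = (1 - τ) * ((1 - τ) * S.p r r) := by
      rw [← mul_assoc, hσ]; ring
    linarith
  have := nonneg_of_mul_nonneg_right this hA
  linarith

/-- The potential decreases by multiples of the squared residual and of the squared increment. -/
theorem potential_step {β τ A σ : ℝ} (hβ : 0 < β) (hτ : 0 < τ) (hA : 0 < A)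
    (hσ : A * σ = (1 - τ) ^ 2) {x : ℕ → E} {y : ℕ → Y} {L : ℕ → E}
    (h : S.IsADMM β τ x y L) {xs : E} {ys : Y} {Ls : E} (hs : S.IsKKT xs ys Ls) (k : ℕ) :
    S.potential β τ σ x y L (ys, Ls) (k + 1)
      + (2 - τ - σ) * S.p (S.res (x (k + 2)) (y (k + 2))) (S.res (x (k + 2)) (y (k + 2)))
      + (1 - A) * S.p (S.B (y (k + 2) - y (k + 1))) (S.B (y (k + 2) - y (k + 1)))
      + S.T (y (k + 2) - y (k + 1)) (y (k + 2) - y (k + 1))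
      ≤ S.potential β τ σ x y L (ys, Ls) k := by
  have h1 := energy_step hβ hτ h hs (k + 1)
  have h2 := cross_le hβ h k
  have h3 := S.cross_split hA hσ (S.B (y (k + 2) - y (k + 1))) (S.res (x (k + 1)) (y (k + 1)))
  simp only [potential, show k + 1 + 1 = k + 2 from rfl] at *
  linarith

theorem tendsto_p {ι : Type*} {l : Filter ι} {f g : ι → E} {f₀ g₀ : E} (hf : Tendsto f l (𝓝 f₀))
    (hg : Tendsto g l (𝓝 g₀)) : Tendsto (fun i => S.p (f i) (g i)) l (𝓝 (S.p f₀ g₀)) :=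
  (S.p_cont.tendsto (f₀, g₀)).comp (hf.prodMk_nhds hg)

theorem tendsto_T {ι : Type*} {l : Filter ι} {f g : ι → Y} {f₀ g₀ : Y} (hf : Tendsto f l (𝓝 f₀))
    (hg : Tendsto g l (𝓝 g₀)) : Tendsto (fun i => S.T (f i) (g i)) l (𝓝 (S.T f₀ g₀)) :=
  (S.T_cont.tendsto (f₀, g₀)).comp (hf.prodMk_nhds hg)

variable [IsTopologicalAddGroup E] [ContinuousSMul ℝ E]
  [IsTopologicalAddGroup Y] [ContinuousSMul ℝ Y] [T2Space Y] [FiniteDimensional ℝ Y]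

theorem continuous_energy (β τ : ℝ) : Continuous (S.energy β τ) := by
  have hB : Continuous S.B := LinearMap.continuous_of_finiteDimensional _
  have h1 : Continuous fun w : Y × E => S.p w.2 w.2 :=
    S.p_cont.comp (continuous_snd.prodMk continuous_snd)
  have h2 : Continuous fun w : Y × E => S.p (S.B w.1) (S.B w.1) :=
    S.p_cont.comp ((hB.comp continuous_fst).prodMk (hB.comp continuous_fst))
  have h3 : Continuous fun w : Y × E => S.T w.1 w.1 :=
    S.T_cont.comp (continuous_fst.prodMk continuous_fst)
  unfold energy
  fun_prop

variable [T2Space E] [FiniteDimensional ℝ E]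

/-- Global convergence of the semi-proximal ADMM with step length below the golden ratio. -/
theorem IsADMM.exists_tendsto {β τ : ℝ} (hβ : 0 < β) (hτ : τ ∈ Set.Ioo (0 : ℝ) ((1 + √5) / 2))
    {x : ℕ → E} {y : ℕ → Y} {L : ℕ → E} (h : S.IsADMM β τ x y L)
    (hex : ∃ xs ys Ls, S.IsKKT xs ys Ls) :
    ∃ xs ys Ls, S.IsKKT xs ys Ls ∧ Tendsto x atTop (𝓝 xs) ∧ Tendsto y atTop (𝓝 ys) ∧
      Tendsto L atTop (𝓝 Ls) := by
  obtain ⟨A, σ, hA0, hA1, hσ0, hσ1, hAσ⟩ := exists_weights hτ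
  have hτ0 : 0 < τ := hτ.1
  have hB : Continuous S.B := LinearMap.continuous_of_finiteDimensional _
  set r : ℕ → E := fun k => S.res (x k) (y k) with hr
  set d : ℕ → Y := fun k => y (k + 1) - y k with hd
  have hpn : ∀ w k, 0 ≤ S.potential β τ σ x y L w k := fun w k => by
    have h1 := S.energy_nonneg (β := β) hτ0 ((y (k + 1), L (k + 1)) - w)
    have h2 := S.T_nonneg (d k)
    have h3 := S.p_nonneg (r (k + 1))
    unfold potential
    positivity
  have hle : ∀ w k, S.energy β τ ((y (k + 1), L (k + 1)) - w) ≤ S.potential β τ σ x y L w k :=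
    fun w k => by
      have h2 := S.T_nonneg (d k)
      have h3 := mul_nonneg hσ0 (S.p_nonneg (r (k + 1)))
      simp only [potential]
      linarith
  have hanti : ∀ {xs ys Ls}, S.IsKKT xs ys Ls → Antitone (S.potential β τ σ x y L (ys, Ls)) :=
    fun hs => antitone_nat_of_succ_le fun k => by
      have h1 := potential_step hβ hτ0 hA0 hAσ h hs k
      have h2 := S.T_nonneg (d (k + 1))
      have h3 := mul_nonneg (sub_nonneg.2 hσ1.le) (S.p_nonneg (r (k + 2)))
      have h4 := mul_nonneg (sub_nonneg.2 hA1.le) (S.p_nonneg (S.B (d (k + 1))))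
      linarith
  obtain ⟨x₀, y₀, L₀, hs⟩ := hex
  have hbdd : BddBelow (Set.range (S.potential β τ σ x y L (y₀, L₀))) :=
    ⟨0, by rintro _ ⟨k, rfl⟩; exact hpn _ k⟩
  -- The potential converges, so its decrements tend to zero.
  have hlim := tendsto_atTop_ciInf (hanti hs) hbdd
  have hdiff : Tendsto (fun k => S.potential β τ σ x y L (y₀, L₀) k
      - S.potential β τ σ x y L (y₀, L₀) (k + 1)) atTop (𝓝 0) := by
    simpa using hlim.sub (hlim.comp (tendsto_add_atTop_nat 1))
  have hr0 : Tendsto r atTop (𝓝 0) := by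
    have h1 : Tendsto (fun k => S.p (r (k + 2)) (r (k + 2))) atTop (𝓝 0) := by
      refine squeeze_zero (fun k => S.p_nonneg _) (fun k => ?_)
        (by simpa using hdiff.const_mul (2 - τ - σ)⁻¹)
      have hpos : 0 < 2 - τ - σ := by linarith
      rw [← div_eq_inv_mul, le_div_iff₀ hpos]
      have h1 := potential_step hβ hτ0 hA0 hAσ h hs k
      have h2 := S.T_nonneg (d (k + 1))
      have h4 := mul_nonneg (sub_nonneg.2 hA1.le) (S.p_nonneg (S.B (d (k + 1))))
      linarith
    rw [← tendsto_add_atTop_iff_nat 2]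
    refine tendsto_of_tendsto_form (q := fun e => S.p e e)
      (S.p_cont.comp (continuous_id.prodMk continuous_id)) (fun s w => ?_) S.p_pos (by simpa using h1)
    simp only [map_smul, LinearMap.smul_apply, smul_eq_mul]; ring
  have hd0 : Tendsto d atTop (𝓝 0) := by
    have h1 : Tendsto (fun k => S.p (S.B (d (k + 1))) (S.B (d (k + 1)))
        + S.T (d (k + 1)) (d (k + 1))) atTop (𝓝 0) := by
      refine squeeze_zero (fun k => add_nonneg (S.p_nonneg _) (S.T_nonneg _)) (fun k => ?_)
        (by simpa using hdiff.const_mul (1 - A)⁻¹)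
      have hpos : 0 < 1 - A := by linarith
      rw [← div_eq_inv_mul, le_div_iff₀ hpos]
      have h1 := potential_step hβ hτ0 hA0 hAσ h hs k
      have h2 := mul_nonneg hA0.le (S.T_nonneg (d (k + 1)))
      have h3 := mul_nonneg (sub_nonneg.2 hσ1.le) (S.p_nonneg (r (k + 2)))
      simp only [hd, hr, show k + 1 + 1 = k + 2 from rfl] at *
      linarith
    rw [← tendsto_add_atTop_iff_nat 1]
    refine tendsto_of_tendsto_form (q := fun e => S.p (S.B e) (S.B e) + S.T e e)
      ?_ (fun s w => ?_) (fun w hw => ?_) (by simpa using h1)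
    · exact (S.p_cont.comp (hB.prodMk hB)).add (S.T_cont.comp (continuous_id.prodMk continuous_id))
    · simp only [map_smul, LinearMap.smul_apply, smul_eq_mul]; ring
    · exact lt_of_le_of_ne (add_nonneg (S.p_nonneg _) (S.T_nonneg _))
        fun h' => hw (S.nondegenerate _ h'.symm)
  -- Boundedness of the energy yields a cluster point, which satisfies the optimality conditions.
  obtain ⟨⟨ys, Ls⟩, φ, hφ, hsub⟩ := exists_tendsto_subseq_of_form_le (S.continuous_energy β τ)
    energy_smul (energy_pos hβ hτ0) (w := fun k => (y (k + 1), L (k + 1))) (w₀ := (y₀, L₀))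
    fun k => (hle _ k).trans (hanti hs (Nat.zero_le k))
  have hy : Tendsto (fun j => y (φ j + 1)) atTop (𝓝 ys) :=
    (continuous_fst.tendsto _).comp hsub
  have hL : Tendsto (fun j => L (φ j + 1)) atTop (𝓝 Ls) :=
    (continuous_snd.tendsto _).comp hsub
  have hrφ : Tendsto (fun j => r (φ j + 1)) atTop (𝓝 0) :=
    hr0.comp ((tendsto_add_atTop_nat 1).comp hφ.tendsto_atTop)
  have hdφ : Tendsto (fun j => d (φ j)) atTop (𝓝 0) := hd0.comp hφ.tendsto_atTop
  have hxr : ∀ k, x k = r k - S.B (y k) + S.c := fun k => by simp only [hr, res]; abel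
  have hx : Tendsto (fun j => x (φ j + 1)) atTop (𝓝 (S.c - S.B ys)) := by
    have := (hrφ.sub ((hB.tendsto ys).comp hy)).add_const S.c
    simp only [Function.comp_def, ← hxr] at this
    convert this using 2
    abel
  have hLr : Tendsto (fun j => L (φ j) + β • r (φ j + 1)) atTop (𝓝 Ls) := by
    have := hL.add (hrφ.const_smul (β - τ * β))
    simp only [smul_zero, add_zero] at this
    refine this.congr fun j => ?_
    rw [h.step_L, sub_smul]
    simp only [hr]
    abel
  have hKKT : S.IsKKT (S.c - S.B ys) ys Ls := by
    refine ⟨?_, fun y' => ?_, by abel⟩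
    · have hB0 : Tendsto (fun j => β • S.B (d (φ j))) atTop (𝓝 0) := by
        have := ((hB.tendsto 0).comp hdφ).const_smul β
        simpa using this
      have h1 : Tendsto (fun j => L (φ j) + β • S.res (x (φ j + 1)) (y (φ j))) atTop (𝓝 Ls) := by
        have := hLr.sub hB0
        rw [sub_zero] at this
        refine this.congr fun j => ?_
        simp only [hr, hd, res, map_sub, smul_sub, smul_add]
        abel
      exact S.K_closed.mem_of_tendsto (hx.prodMk_nhds h1)
        (Eventually.of_forall fun j => h.step_x (φ j))
    · have h1 := ((S.tendsto_p hLr (tendsto_const_nhds (x := S.B y'))).const_add (S.b y')).add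
        ((S.tendsto_T hdφ (tendsto_const_nhds (x := y'))).const_mul β)
      have h2 := tendsto_nhds_unique h1
        (tendsto_const_nhds.congr fun j => (h.step_y (φ j) y').symm)
      simpa using h2
  -- The potential relative to the cluster point is antitone and tends to zero along `φ`.
  have hpot : Tendsto (S.potential β τ σ x y L (ys, Ls)) atTop (𝓝 0) := by
    have hsubpot : Tendsto (fun j => S.potential β τ σ x y L (ys, Ls) (φ j)) atTop (𝓝 0) := by
      have h1 : Tendsto (fun j => S.energy β τ ((y (φ j + 1), L (φ j + 1)) - (ys, Ls))) atTop
          (𝓝 0) := by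
        have := ((S.continuous_energy β τ).tendsto _).comp (hsub.sub_const (ys, Ls))
        have e0 : S.energy β τ ((ys, Ls) - (ys, Ls)) = 0 := by simp [energy]
        rwa [e0] at this
      have := (h1.add (S.tendsto_T hdφ hdφ)).add ((S.tendsto_p hrφ hrφ).const_mul σ)
      simpa [potential, hd, hr] using this
    have hb' : BddBelow (Set.range (S.potential β τ σ x y L (ys, Ls))) :=
      ⟨0, by rintro _ ⟨k, rfl⟩; exact hpn _ k⟩
    have hl' := tendsto_atTop_ciInf (hanti hKKT) hb'
    rwa [tendsto_nhds_unique (hl'.comp hφ.tendsto_atTop) hsubpot] at hl'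
  have hyL : Tendsto (fun k => (y (k + 1), L (k + 1))) atTop (𝓝 (ys, Ls)) :=
    tendsto_of_tendsto_form (S.continuous_energy β τ) energy_smul (energy_pos hβ hτ0)
      (squeeze_zero (fun k => energy_nonneg hτ0 _) (hle _) hpot)
  have hy' : Tendsto y atTop (𝓝 ys) :=
    (tendsto_add_atTop_iff_nat 1).1 ((continuous_fst.tendsto _).comp hyL)
  have hL' : Tendsto L atTop (𝓝 Ls) :=
    (tendsto_add_atTop_iff_nat 1).1 ((continuous_snd.tendsto _).comp hyL)
  refine ⟨_, ys, Ls, hKKT, ?_, hy', hL'⟩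
  have := (hr0.sub ((hB.tendsto ys).comp hy')).add_const S.c
  simp only [Function.comp_def, ← hxr] at this
  convert this using 2
  abel

end SplitProblem

namespace WassersteinBarycenter

variable {N m : ℕ} {n : Fin N → ℕ}

/-! ### The dual barycenter problem as a splitting problem -/

/-- The Euclidean inner product on the space of residuals `(r, R)` of the dual problem. -/
def pairing : ((Fin m → ℝ) × MatFam m n) →ₗ[ℝ] ((Fin m → ℝ) × MatFam m n) →ₗ[ℝ] ℝ :=
  LinearMap.mk₂ ℝ (fun x x' => x.1 ⬝ᵥ x'.1 + ∑ t, frobInner (x.2 t) (x'.2 t))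
    (fun x x' w => by
      simp only [frobInner, Prod.fst_add, Prod.snd_add, Pi.add_apply, Matrix.add_apply, add_mul,
        Finset.sum_add_distrib, add_dotProduct]
      ring)
    (fun c x w => by
      simp only [frobInner, Prod.smul_fst, Prod.smul_snd, Pi.smul_apply, Matrix.smul_apply,
        smul_eq_mul, mul_assoc, ← Finset.mul_sum, smul_dotProduct, mul_add])
    (fun x w w' => by
      simp only [frobInner, Prod.fst_add, Prod.snd_add, Pi.add_apply, Matrix.add_apply, mul_add,
        Finset.sum_add_distrib, dotProduct_add]
      ring)
    (fun c x w => by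
      simp only [frobInner, Prod.smul_fst, Prod.smul_snd, Pi.smul_apply, Matrix.smul_apply,
        smul_eq_mul, mul_left_comm _ c, ← Finset.mul_sum, dotProduct_smul, mul_add])

theorem pairing_apply (x x' : (Fin m → ℝ) × MatFam m n) :
    pairing x x' = x.1 ⬝ᵥ x'.1 + ∑ t, frobInner (x.2 t) (x'.2 t) := rfl

/-- The linear map `(y, z) ↦ (∑ₜ y⁽ᵗ⁾, (-y⁽ᵗ⁾ eᵀ - e (z⁽ᵗ⁾)ᵀ)ₜ)`. -/
def couplingMap : (YFam N m × ZFam n) →ₗ[ℝ] ((Fin m → ℝ) × MatFam m n) where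
  toFun w := (∑ t, w.1 t, fun t => -Matrix.vecMulVec (w.1 t) 1 - Matrix.vecMulVec 1 (w.2 t))
  map_add' w w' := by
    ext1
    · simp [Finset.sum_add_distrib]
    · funext t
      simp only [Prod.fst_add, Prod.snd_add, Pi.add_apply, Matrix.add_vecMulVec,
        Matrix.vecMulVec_add]
      abel
  map_smul' c w := by
    ext1
    · simp [Finset.smul_sum]
    · funext t
      simp [Matrix.vecMulVec_smul, smul_sub]

theorem couplingMap_apply (w : YFam N m × ZFam n) :
    couplingMap w = (∑ t, w.1 t,
      fun t => -Matrix.vecMulVec (w.1 t) 1 - Matrix.vecMulVec 1 (w.2 t)) := rfl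

/-- The linear functional `(y, z) ↦ ∑ₜ ⟨z⁽ᵗ⁾, a⁽ᵗ⁾⟩`. -/
def linearCost (a : ZFam n) : (YFam N m × ZFam n) →ₗ[ℝ] ℝ where
  toFun w := ∑ t, w.2 t ⬝ᵥ a t
  map_add' w w' := by simp [add_dotProduct, Finset.sum_add_distrib]
  map_smul' c w := by simp [smul_dotProduct, Finset.mul_sum]

theorem linearCost_apply (a : ZFam n) (w : YFam N m × ZFam n) :
    linearCost a w = ∑ t, w.2 t ⬝ᵥ a t := rfl

/-- The proximal term produced by the symmetric Gauss-Seidel sweep `z, y, z`. It only involves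
the sums of the entries of the `y⁽ᵗ⁾`. -/
noncomputable def sweepTerm : (YFam N m × ZFam n) →ₗ[ℝ] (YFam N m × ZFam n) →ₗ[ℝ] ℝ :=
  LinearMap.mk₂ ℝ (fun w w' => ∑ t, (n t / m : ℝ) * ((∑ i, w.1 t i) * ∑ i, w'.1 t i))
    (fun w w' v => by
      simp only [Prod.fst_add, Pi.add_apply, Finset.sum_add_distrib, add_mul, mul_add])
    (fun c w v => by
      simp only [Prod.smul_fst, Pi.smul_apply, smul_eq_mul, ← Finset.mul_sum, mul_assoc,
        mul_left_comm _ c])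
    (fun w v v' => by
      simp only [Prod.fst_add, Pi.add_apply, Finset.sum_add_distrib, mul_add])
    (fun c w v => by
      simp only [Prod.smul_fst, Pi.smul_apply, smul_eq_mul, ← Finset.mul_sum,
        mul_left_comm _ c])

theorem sweepTerm_apply (w w' : YFam N m × ZFam n) :
    sweepTerm w w' = ∑ t, (n t / m : ℝ) * ((∑ i, w.1 t i) * ∑ i, w'.1 t i) := rfl

/-- With `x = (-u, V)`, the relation `-L ∈ ∂f x` for
`f x = δ*(u) + ∑ₜ δ₊(V⁽ᵗ⁾)`, spelled out entrywise. -/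
def OptimalityRel (x L : (Fin m → ℝ) × MatFam m n) : Prop :=
  L.1 ∈ stdSimplex ℝ (Fin m) ∧ (∀ i, L.1 ⬝ᵥ x.1 ≤ x.1 i) ∧ (∀ t i j, 0 ≤ x.2 t i j) ∧
    (∀ t i j, 0 ≤ L.2 t i j) ∧ ∑ t, frobInner (L.2 t) (x.2 t) ≤ 0

theorem frobInner_nonneg {k l : ℕ} {A B : Matrix (Fin k) (Fin l) ℝ} (hA : ∀ i j, 0 ≤ A i j)
    (hB : ∀ i j, 0 ≤ B i j) : 0 ≤ frobInner A B :=
  Finset.sum_nonneg fun i _ => Finset.sum_nonneg fun j _ => mul_nonneg (hA i j) (hB i j)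

theorem le_dotProduct_of_mem_stdSimplex {w x : Fin m → ℝ} {c : ℝ} (hw : w ∈ stdSimplex ℝ (Fin m))
    (h : ∀ i, c ≤ x i) : c ≤ w ⬝ᵥ x := by
  calc c = ∑ i, w i * c := by rw [← Finset.sum_mul, hw.2, one_mul]
    _ ≤ w ⬝ᵥ x := Finset.sum_le_sum fun i _ => mul_le_mul_of_nonneg_left (h i) (hw.1 i)

theorem OptimalityRel.anti {x L x' L' : (Fin m → ℝ) × MatFam m n} (h : OptimalityRel x L)
    (h' : OptimalityRel x' L') : pairing (L - L') (x - x') ≤ 0 := by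
  obtain ⟨h1, h2, h3, h4, h5⟩ := h
  obtain ⟨h1', h2', h3', h4', h5'⟩ := h'
  have a1 := le_dotProduct_of_mem_stdSimplex h1' h2
  have a2 := le_dotProduct_of_mem_stdSimplex h1 h2'
  have a3 : 0 ≤ ∑ t, frobInner (L.2 t) (x'.2 t) :=
    Finset.sum_nonneg fun t _ => frobInner_nonneg (h4 t) (h3' t)
  have a4 : 0 ≤ ∑ t, frobInner (L'.2 t) (x.2 t) :=
    Finset.sum_nonneg fun t _ => frobInner_nonneg (h4' t) (h3 t)
  simp only [map_sub, LinearMap.sub_apply, pairing_apply]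
  linarith

theorem isClosed_optimalityRel :
    IsClosed {w : ((Fin m → ℝ) × MatFam m n) × ((Fin m → ℝ) × MatFam m n) |
      OptimalityRel w.1 w.2} := by
  have hV : ∀ t i j, Continuous
      fun w : ((Fin m → ℝ) × MatFam m n) × ((Fin m → ℝ) × MatFam m n) => w.1.2 t i j :=
    fun t i j => by fun_prop
  have hL : ∀ t i j, Continuous
      fun w : ((Fin m → ℝ) × MatFam m n) × ((Fin m → ℝ) × MatFam m n) => w.2.2 t i j :=
    fun t i j => by fun_prop
  have c1 := (isCompact_stdSimplex ℝ (Fin m)).isClosed.preimage (continuous_fst.comp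
    (continuous_snd (X := (Fin m → ℝ) × MatFam m n) (Y := (Fin m → ℝ) × MatFam m n)))
  have c2 : IsClosed {w : ((Fin m → ℝ) × MatFam m n) × ((Fin m → ℝ) × MatFam m n) |
      ∀ i, w.2.1 ⬝ᵥ w.1.1 ≤ w.1.1 i} := by
    simp only [Set.ofPred_forall]
    exact isClosed_iInter fun i => isClosed_le (by unfold dotProduct; fun_prop) (by fun_prop)
  have c3 : IsClosed {w : ((Fin m → ℝ) × MatFam m n) × ((Fin m → ℝ) × MatFam m n) |
      ∀ t i j, 0 ≤ w.1.2 t i j} := by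
    simp only [Set.ofPred_forall]
    exact isClosed_iInter fun t => isClosed_iInter fun i => isClosed_iInter fun j =>
      isClosed_le continuous_const (hV t i j)
  have c4 : IsClosed {w : ((Fin m → ℝ) × MatFam m n) × ((Fin m → ℝ) × MatFam m n) |
      ∀ t i j, 0 ≤ w.2.2 t i j} := by
    simp only [Set.ofPred_forall]
    exact isClosed_iInter fun t => isClosed_iInter fun i => isClosed_iInter fun j =>
      isClosed_le continuous_const (hL t i j)
  have c5 : IsClosed {w : ((Fin m → ℝ) × MatFam m n) × ((Fin m → ℝ) × MatFam m n) |
      ∑ t, frobInner (w.2.2 t) (w.1.2 t) ≤ 0} := by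
    refine isClosed_le ?_ continuous_const
    unfold frobInner
    fun_prop
  exact c1.inter (c2.inter (c3.inter (c4.inter c5)))

theorem pairing_symm (x x' : (Fin m → ℝ) × MatFam m n) : pairing x x' = pairing x' x := by
  simp only [pairing_apply, frobInner, dotProduct_comm x.1, mul_comm (x.2 _ _ _)]

theorem pairing_self_pos (x : (Fin m → ℝ) × MatFam m n) (hx : x ≠ 0) : 0 < pairing x x := by
  have h1 : 0 ≤ x.1 ⬝ᵥ x.1 := Finset.sum_nonneg fun i _ => mul_self_nonneg _
  have h2 : ∀ t, 0 ≤ frobInner (x.2 t) (x.2 t) := fun t =>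
    Finset.sum_nonneg fun i _ => Finset.sum_nonneg fun j _ => mul_self_nonneg _
  have h3 : 0 ≤ ∑ t, frobInner (x.2 t) (x.2 t) := Finset.sum_nonneg fun t _ => h2 t
  rw [pairing_apply]
  refine lt_of_le_of_ne (add_nonneg h1 h3) fun h => hx ?_
  have h4 : x.1 ⬝ᵥ x.1 = 0 := by linarith
  have h5 : ∑ t, frobInner (x.2 t) (x.2 t) = 0 := by linarith
  ext1
  · exact dotProduct_self_eq_zero.1 h4
  · funext t
    ext i j
    have h6 := (Finset.sum_eq_zero_iff_of_nonneg fun t _ => h2 t).1 h5 t (Finset.mem_univ t)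
    have h7 := (Finset.sum_eq_zero_iff_of_nonneg
      fun i _ => Finset.sum_nonneg fun j _ => mul_self_nonneg (x.2 t i j)).1 h6 i (Finset.mem_univ i)
    have h8 := (Finset.sum_eq_zero_iff_of_nonneg
      fun j _ => mul_self_nonneg (x.2 t i j)).1 h7 j (Finset.mem_univ j)
    exact mul_self_eq_zero.1 h8

theorem sweepTerm_self_nonneg (w : YFam N m × ZFam n) : 0 ≤ sweepTerm w w := by
  rw [sweepTerm_apply]
  exact Finset.sum_nonneg fun t _ => mul_nonneg (by positivity) (mul_self_nonneg _)

/-- The proximal term of the sweep makes the second block strongly convex: `∑ₜ y⁽ᵗ⁾` and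
`y⁽ᵗ⁾ eᵀ + e (z⁽ᵗ⁾)ᵀ` alone do not determine `(y, z)`, as constants of total
sum zero may be added to the `y⁽ᵗ⁾` and subtracted from the `z⁽ᵗ⁾`. -/
theorem eq_zero_of_pairing_add_sweepTerm (hm : 0 < m) (hn : ∀ t, 0 < n t) (w : YFam N m × ZFam n)
    (h : pairing (couplingMap w) (couplingMap w) + sweepTerm w w = 0) : w = 0 := by
  have hm' : (0 : ℝ) < m := by exact_mod_cast hm
  have hT : ∀ t, 0 ≤ (n t / m : ℝ) * ((∑ i, w.1 t i) * ∑ i, w.1 t i) := fun t =>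
    mul_nonneg (by positivity) (mul_self_nonneg _)
  have hT' := sweepTerm_self_nonneg w
  have hB : couplingMap w = 0 := by
    by_contra hne
    have := pairing_self_pos _ hne
    linarith
  rw [hB, map_zero, zero_add, sweepTerm_apply] at h
  have hsum : ∀ t, ∑ i, w.1 t i = 0 := fun t => by
    have h1 := (Finset.sum_eq_zero_iff_of_nonneg fun t _ => hT t).1 h t (Finset.mem_univ t)
    have h2 : (n t / m : ℝ) ≠ 0 := by
      have : (0 : ℝ) < n t := by exact_mod_cast hn t
      positivity
    simpa [h2] using h1
  have hyz : ∀ t i j, w.1 t i = -w.2 t j := fun t i j => by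
    have h1 := congrFun (congrFun (congrFun (congrArg Prod.snd hB) t) i) j
    simp [couplingMap_apply] at h1
    linarith
  have hz : ∀ t j, w.2 t j = 0 := fun t j => by
    have h1 := hsum t
    rw [Finset.sum_congr rfl fun i _ => hyz t i j] at h1
    simpa [hm.ne'] using h1
  ext t i
  · rw [hyz t i ⟨0, hn t⟩, hz]; simp
  · rw [hz]; simp

/-- The dual barycenter problem as a splitting problem. Its first variable is `x = (-u, V)`, the
second one `(y, z)`, and `x + B (y, z) - c` is the pair of residuals of the dual constraints. -/
noncomputable def dualSplit (hm : 0 < m) (hn : ∀ t, 0 < n t) (a : ZFam n) (D : MatFam m n) :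
    SplitProblem ((Fin m → ℝ) × MatFam m n) (YFam N m × ZFam n) where
  p := pairing
  T := sweepTerm
  B := couplingMap
  b := linearCost a
  c := (0, D)
  K := OptimalityRel
  p_symm := pairing_symm
  p_pos := pairing_self_pos
  p_cont := by
    simp only [pairing_apply, frobInner, dotProduct]
    fun_prop
  T_symm w w' := by simp only [sweepTerm_apply, mul_comm (∑ i, w.1 _ i)]
  T_nonneg := sweepTerm_self_nonneg
  T_cont := by
    simp only [sweepTerm_apply]
    fun_prop
  nondegenerate := eq_zero_of_pairing_add_sweepTerm hm hn
  K_closed := isClosed_optimalityRel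
  K_anti := OptimalityRel.anti

theorem residual_eq (D V : MatFam m n) (u : Fin m → ℝ) (y : YFam N m) (z : ZFam n) :
    (-u, V) + couplingMap (y, z) - ((0 : Fin m → ℝ), D) = (residualU u y, residualV D V y z) := by
  simp only [couplingMap_apply, residualU]
  ext1
  · simp only [Prod.fst_sub, Prod.fst_add, sub_zero]; abel
  · funext t
    simp only [Prod.snd_sub, Prod.snd_add, Pi.sub_apply, Pi.add_apply, residualV]; abel

theorem pairing_couplingMap (w w' : YFam N m × ZFam n) :
    pairing (couplingMap w) (couplingMap w') = (∑ t, w.1 t) ⬝ᵥ (∑ t, w'.1 t)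
      + ∑ t, (n t * (w.1 t ⬝ᵥ w'.1 t) + (∑ i, w.1 t i) * (∑ j, w'.2 t j)
        + (∑ j, w.2 t j) * (∑ i, w'.1 t i) + m * (w.2 t ⬝ᵥ w'.2 t)) := by
  rw [pairing_apply]
  simp only [couplingMap_apply]
  congr 1
  refine Finset.sum_congr rfl fun t _ => ?_
  have : ∀ i j, (-Matrix.vecMulVec (w.1 t) 1 - Matrix.vecMulVec 1 (w.2 t) :
          Matrix (Fin m) (Fin (n t)) ℝ) i j
        * (-Matrix.vecMulVec (w'.1 t) 1 - Matrix.vecMulVec 1 (w'.2 t) :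
          Matrix (Fin m) (Fin (n t)) ℝ) i j
      = w.1 t i * w'.1 t i + w.1 t i * w'.2 t j + w.2 t j * w'.1 t i + w.2 t j * w'.2 t j := by
    intro i j
    simp only [Matrix.sub_apply, Matrix.neg_apply, Matrix.vecMulVec_apply, Pi.one_apply]
    ring
  simp only [frobInner, this, Finset.sum_add_distrib, Finset.sum_const, Finset.card_univ,
    Fintype.card_fin, nsmul_eq_mul, ← Finset.mul_sum, ← Finset.sum_mul, dotProduct]

/-- The linear part of the Lagrangian vanishes identically exactly when `(λ, Λ)` satisfies the
equality constraints of the primal problem. -/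
theorem linearCost_add_pairing (a : ZFam n) (lam : Fin m → ℝ) (Lam : MatFam m n)
    (w : YFam N m × ZFam n) :
    linearCost a w + pairing (lam, Lam) (couplingMap w)
      = ∑ t, (lam - (Lam t).mulVec 1) ⬝ᵥ w.1 t
        + ∑ t, (a t - (Lam t).transpose.mulVec 1) ⬝ᵥ w.2 t := by
  rw [linearCost_apply, pairing_apply]
  simp only [couplingMap_apply, dotProduct_sum]
  rw [← Finset.sum_add_distrib, ← Finset.sum_add_distrib, ← Finset.sum_add_distrib]
  refine Finset.sum_congr rfl fun t _ => ?_
  have : frobInner (Lam t) (-Matrix.vecMulVec (w.1 t) 1 - Matrix.vecMulVec 1 (w.2 t))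
      = - ((Lam t).mulVec 1 ⬝ᵥ w.1 t) - (Lam t).transpose.mulVec 1 ⬝ᵥ w.2 t := by
    simp only [frobInner, Matrix.sub_apply, Matrix.neg_apply, Matrix.vecMulVec_apply,
      Pi.one_apply, mul_one, one_mul, mul_sub, mul_neg, Finset.sum_sub_distrib,
      Finset.sum_neg_distrib, dotProduct, Matrix.mulVec, Matrix.transpose_apply, Finset.sum_mul]
    congr 1
    exact Finset.sum_comm
  rw [this, sub_dotProduct, sub_dotProduct, dotProduct_comm (w.2 t) (a t)]
  ring

/-! ### The augmented Lagrangian and the first order conditions of the steps -/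

theorem conjugate_indicatorFn_stdSimplex (hm : 0 < m) (u : Fin m → ℝ) :
    conjugate (indicatorFn (stdSimplex ℝ (Fin m))) u = ((⨆ i, u i : ℝ) : EReal) := by
  have : Nonempty (Fin m) := ⟨⟨0, hm⟩⟩
  apply le_antisymm
  · refine iSup_le fun x => ?_
    by_cases hx : x ∈ stdSimplex ℝ (Fin m)
    · simp only [indicatorFn, hx, if_true, sub_zero, EReal.coe_le_coe_iff]
      calc u ⬝ᵥ x ≤ ∑ i, (⨆ i, u i) * x i := Finset.sum_le_sum fun i _ =>
            mul_le_mul_of_nonneg_right (le_ciSup (Finite.bddAbove_range u) i) (hx.1 i)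
        _ = ⨆ i, u i := by rw [← Finset.mul_sum, hx.2, mul_one]
    · simp [indicatorFn, hx]
  · obtain ⟨i, hi⟩ := exists_eq_ciSup_of_finite (f := u)
    refine le_iSup_of_le (Pi.single i 1) ?_
    simp [indicatorFn, single_mem_stdSimplex, ← hi]

theorem sum_indicatorFn_of_nonneg {V : MatFam m n} (hV : ∀ t i j, 0 ≤ V t i j) :
    ∑ t, indicatorFn (nonnegMatrices m (n t)) (V t) = 0 :=
  Finset.sum_eq_zero fun t _ => if_pos (hV t)

theorem sum_indicatorFn_of_not_nonneg {V : MatFam m n} (hV : ¬ ∀ t i j, 0 ≤ V t i j) :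
    ∑ t, indicatorFn (nonnegMatrices m (n t)) (V t) = ⊤ := by
  push Not at hV
  obtain ⟨t, i, j, h⟩ := hV
  have ht : indicatorFn (nonnegMatrices m (n t)) (V t) = ⊤ :=
    if_neg fun hmem => absurd (hmem i j) (not_le.2 h)
  rw [eq_top_iff, ← ht]
  refine Finset.single_le_sum (f := fun t => indicatorFn (nonnegMatrices m (n t)) (V t))
    (fun s _ => ?_) (Finset.mem_univ t)
  unfold indicatorFn
  split_ifs <;> simp

theorem dualObjective_of_nonneg (hm : 0 < m) (a : ZFam n) (u : Fin m → ℝ) {V : MatFam m n}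
    (hV : ∀ t i j, 0 ≤ V t i j) (y : YFam N m) (z : ZFam n) :
    dualObjective a u V z = (((⨆ i, u i) + linearCost a (y, z) : ℝ) : EReal) := by
  rw [dualObjective, conjugate_indicatorFn_stdSimplex hm, sum_indicatorFn_of_nonneg hV, add_zero,
    EReal.coe_add, linearCost_apply]

theorem dualObjective_of_not_nonneg (hm : 0 < m) (a : ZFam n) (u : Fin m → ℝ) {V : MatFam m n}
    (hV : ¬ ∀ t i j, 0 ≤ V t i j) (z : ZFam n) : dualObjective a u V z = ⊤ := by
  rw [dualObjective, conjugate_indicatorFn_stdSimplex hm, sum_indicatorFn_of_not_nonneg hV,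
    EReal.coe_add_top, EReal.top_add_coe]

/-- The differentiable part of the augmented Lagrangian, in the variables `x = (-u, V)`,
`w = (y, z)` and `L = (λ, Λ)`. -/
noncomputable def smoothPart (a : ZFam n) (D : MatFam m n) (β : ℝ) (x : (Fin m → ℝ) × MatFam m n)
    (w : YFam N m × ZFam n) (L : (Fin m → ℝ) × MatFam m n) : ℝ :=
  linearCost a w + pairing L (x + couplingMap w - (0, D))
    + β / 2 * pairing (x + couplingMap w - (0, D)) (x + couplingMap w - (0, D))

theorem smoothPart_add_left (a : ZFam n) (D : MatFam m n) (β : ℝ) (x e : (Fin m → ℝ) × MatFam m n)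
    (w : YFam N m × ZFam n) (L : (Fin m → ℝ) × MatFam m n) (s : ℝ) :
    smoothPart a D β (x + s • e) w L = smoothPart a D β x w L
      + (s * pairing (L + β • (x + couplingMap w - (0, D))) e + s ^ 2 * (β / 2 * pairing e e)) := by
  have : x + s • e + couplingMap w - (0, D) = (x + couplingMap w - (0, D)) + s • e := by abel
  simp only [smoothPart, this]
  generalize x + couplingMap w - (0, D) = r
  simp only [map_add, map_smul, LinearMap.add_apply, LinearMap.smul_apply, smul_eq_mul,
    pairing_symm e r]
  ring

theorem smoothPart_add_right (a : ZFam n) (D : MatFam m n) (β : ℝ) (x : (Fin m → ℝ) × MatFam m n)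
    (w d : YFam N m × ZFam n) (L : (Fin m → ℝ) × MatFam m n) (s : ℝ) :
    smoothPart a D β x (w + s • d) L = smoothPart a D β x w L
      + (s * (linearCost a d + pairing (L + β • (x + couplingMap w - (0, D))) (couplingMap d))
        + s ^ 2 * (β / 2 * pairing (couplingMap d) (couplingMap d))) := by
  have : x + couplingMap (w + s • d) - (0, D)
      = (x + couplingMap w - (0, D)) + s • couplingMap d := by
    rw [map_add, map_smul]; abel
  simp only [smoothPart, this]
  generalize x + couplingMap w - (0, D) = r
  simp only [map_add, map_smul, LinearMap.add_apply, LinearMap.smul_apply, smul_eq_mul,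
    pairing_symm (couplingMap d) r]
  ring

theorem augLagrangian_eq (a : ZFam n) (D : MatFam m n) (β : ℝ) (u : Fin m → ℝ)
    (V : MatFam m n) (y : YFam N m) (z : ZFam n) (lam : Fin m → ℝ) (Lam : MatFam m n) :
    augLagrangian a D β u V y z lam Lam = dualObjective a u V z
      + ((smoothPart a D β (-u, V) (y, z) (lam, Lam) - linearCost a (y, z) : ℝ) : EReal) := by
  rw [augLagrangian, lagrangian, add_assoc, ← EReal.coe_add]
  congr 2
  simp only [smoothPart, residual_eq, pairing_apply]
  ring

theorem augLagrangian_of_nonneg (hm : 0 < m) (a : ZFam n) (D : MatFam m n) (β : ℝ)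
    (u : Fin m → ℝ) {V : MatFam m n} (hV : ∀ t i j, 0 ≤ V t i j) (y : YFam N m) (z : ZFam n)
    (lam : Fin m → ℝ) (Lam : MatFam m n) :
    augLagrangian a D β u V y z lam Lam
      = (((⨆ i, u i) + smoothPart a D β (-u, V) (y, z) (lam, Lam) : ℝ) : EReal) := by
  rw [augLagrangian_eq, dualObjective_of_nonneg hm a u hV y z, ← EReal.coe_add]
  congr 1
  ring

theorem augLagrangian_of_not_nonneg (hm : 0 < m) (a : ZFam n) (D : MatFam m n) (β : ℝ)
    (u : Fin m → ℝ) {V : MatFam m n} (hV : ¬ ∀ t i j, 0 ≤ V t i j) (y : YFam N m) (z : ZFam n)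
    (lam : Fin m → ℝ) (Lam : MatFam m n) :
    augLagrangian a D β u V y z lam Lam = ⊤ := by
  rw [augLagrangian_eq, dualObjective_of_not_nonneg hm a u hV, EReal.top_add_coe]

theorem nonneg_of_forall_small {A C : ℝ} (h : ∀ s, 0 < s → s ≤ 1 → 0 ≤ s * A + s ^ 2 * C) :
    0 ≤ A := by
  have ht : Tendsto (fun s : ℝ => A + s * C) (𝓝[>] 0) (𝓝 A) := by
    have : Tendsto (fun s : ℝ => A + s * C) (𝓝 0) (𝓝 (A + 0 * C)) :=
      (Continuous.tendsto (by fun_prop) 0)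
    simp only [zero_mul, add_zero] at this
    exact this.mono_left nhdsWithin_le_nhds
  refine ge_of_tendsto ht ?_
  filter_upwards [Ioc_mem_nhdsGT (zero_lt_one' ℝ)] with s hs
  have h1 := h s hs.1 hs.2
  have h2 : 0 ≤ s * (A + s * C) := by linarith
  exact nonneg_of_mul_nonneg_right h2 hs.1

/-- If `w` minimizes the smooth part along the line through `w` in direction `d`, then the
derivative in that direction vanishes. -/
theorem smoothPart_stationary {a : ZFam n} {D : MatFam m n} {β : ℝ} {x : (Fin m → ℝ) × MatFam m n}
    {w : YFam N m × ZFam n} {L : (Fin m → ℝ) × MatFam m n} {d : YFam N m × ZFam n}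
    (h : ∀ s : ℝ, smoothPart a D β x w L ≤ smoothPart a D β x (w + s • d) L) :
    linearCost a d + pairing (L + β • (x + couplingMap w - (0, D))) (couplingMap d) = 0 := by
  refine le_antisymm ?_ ?_
  · rw [← neg_nonneg]
    refine nonneg_of_forall_small (C := β / 2 * pairing (couplingMap d) (couplingMap d))
      fun s _ _ => ?_
    have := h (-s)
    rw [smoothPart_add_right] at this
    linarith
  · refine nonneg_of_forall_small (C := β / 2 * pairing (couplingMap d) (couplingMap d))
      fun s _ _ => ?_
    have := h s
    rw [smoothPart_add_right] at this
    linarith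

theorem pairing_single (L : (Fin m → ℝ) × MatFam m n) (t : Fin N) (i : Fin m) (j : Fin (n t)) :
    pairing L (0, Pi.single t (Matrix.single i j 1)) = L.2 t i j := by
  rw [pairing_apply]
  simp only [dotProduct_zero, zero_add]
  rw [Finset.sum_eq_single t]
  · simp only [frobInner, Pi.single_eq_same]
    rw [Finset.sum_eq_single i, Finset.sum_eq_single j]
    · simp
    · intro j' _ hj
      simp [hj.symm]
    · simp
    · intro i' _ hi
      exact Finset.sum_eq_zero fun j' _ => by simp [hi.symm]
    · simp
  · intro t' _ ht
    simp [frobInner, Pi.single_eq_of_ne ht]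
  · simp

/-- First order optimality of the joint minimization over `u` and `V`. -/
theorem optimalityRel_of_isMinOn (hm : 0 < m) {a : ZFam n} {D : MatFam m n} {β : ℝ}
    {u : Fin m → ℝ} {V : MatFam m n} {y : YFam N m} {z : ZFam n} {lam : Fin m → ℝ}
    {Lam : MatFam m n}
    (h : IsMinOn (fun q : (Fin m → ℝ) × MatFam m n => augLagrangian a D β q.1 q.2 y z lam Lam)
      Set.univ (u, V)) :
    OptimalityRel (-u, V)
      ((lam, Lam) + β • ((-u, V) + couplingMap (y, z) - ((0 : Fin m → ℝ), D))) := by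
  have : Nonempty (Fin m) := ⟨⟨0, hm⟩⟩
  have hmin : ∀ u' V', augLagrangian a D β u V y z lam Lam
      ≤ augLagrangian a D β u' V' y z lam Lam := fun u' V' => isMinOn_univ_iff.1 h (u', V')
  have hV : ∀ t i j, 0 ≤ V t i j := by
    by_contra hV
    have h0 := hmin 0 0
    rw [augLagrangian_of_not_nonneg hm a D β u hV, augLagrangian_of_nonneg hm a D β 0
      (V := 0) (fun _ _ _ => le_rfl)] at h0
    exact EReal.coe_ne_top _ (top_le_iff.1 h0)
  set W := (lam, Lam) + β • ((-u, V) + couplingMap (y, z) - ((0 : Fin m → ℝ), D)) with hW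
  -- The directional derivative of the objective is nonnegative in every admissible direction.
  have key : ∀ (du : Fin m → ℝ) (dV : MatFam m n) (δ : ℝ),
      (∀ s : ℝ, 0 < s → s ≤ 1 → ∀ i, (u + s • du) i ≤ (⨆ i, u i) + s * δ) →
      (∀ s : ℝ, 0 < s → s ≤ 1 → ∀ t i j, 0 ≤ (V + s • dV) t i j) →
      0 ≤ δ + pairing W (-du, dV) := by
    intro du dV δ hu hdV
    refine nonneg_of_forall_small (C := β / 2 * pairing (-du, dV) (-du, dV)) fun s hs hs1 => ?_
    have h1 := hmin (u + s • du) (V + s • dV)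
    rw [augLagrangian_of_nonneg hm a D β u hV, augLagrangian_of_nonneg hm a D β _
      (hdV s hs hs1), EReal.coe_le_coe_iff] at h1
    have h2 : ((-(u + s • du), V + s • dV) : (Fin m → ℝ) × MatFam m n)
        = (-u, V) + s • (-du, dV) := by
      ext1
      · simp; abel
      · simp
    rw [h2, smoothPart_add_left, ← hW] at h1
    have h3 := ciSup_le (hu s hs hs1)
    linarith
  have hbound := fun i => le_ciSup (Finite.bddAbove_range u) i
  have hV' : ∀ s : ℝ, 0 < s → s ≤ 1 → ∀ t i j, 0 ≤ (V + s • (0 : MatFam m n)) t i j := by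
    simpa using fun _ _ _ => hV
  -- The directions `-eᵢ` and `±e` put the multiplier in the simplex, `-u` and `-V` give the
  -- complementarity relations, and the unit matrices give nonnegativity.
  refine ⟨⟨fun i => ?_, ?_⟩, fun i => ?_, hV, fun t i j => ?_, ?_⟩
  · have h1 := key (-Pi.single i 1) 0 0 (fun s hs _ j => ?_) hV'
    · simpa [pairing_apply, frobInner] using h1
    · have := hbound j
      by_cases hj : j = i
      · subst hj; simp; linarith
      · simpa [hj] using this
  · have h1 := key 1 0 1 (fun s hs _ j => by simpa using hbound j) hV'
    have h2 := key (-1) 0 (-1) (fun s hs _ j => by simpa using hbound j) hV'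
    simp [pairing_apply, frobInner, dotProduct] at h1 h2
    exact le_antisymm (by linarith) (by linarith)
  · have h1 := key (-u) 0 (-⨆ i, u i) (fun s hs hs1 j => ?_) hV'
    · simp only [pairing_apply, frobInner, neg_neg, Pi.zero_apply, Matrix.zero_apply, mul_zero,
        Finset.sum_const_zero, add_zero] at h1
      have := hbound i
      simp only [dotProduct_neg, Pi.neg_apply]
      linarith
    · have := mul_le_mul_of_nonneg_left (hbound j) (sub_nonneg.2 hs1)
      simp only [Pi.add_apply, Pi.smul_apply, Pi.neg_apply, smul_eq_mul]
      linarith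
  · have h1 := key 0 (Pi.single t (Matrix.single i j 1)) 0 (by simpa using fun _ _ _ => hbound)
      fun s hs _ t' i' j' => ?_
    · rwa [neg_zero, pairing_single, zero_add] at h1
    · have h2 := hV t' i' j'
      have h3 : 0 ≤ (Pi.single t (Matrix.single i j 1) : MatFam m n) t' i' j' := by
        by_cases ht : t' = t
        · subst ht
          rw [Pi.single_eq_same, Matrix.single_apply]
          split_ifs <;> norm_num
        · rw [Pi.single_eq_of_ne ht]; exact le_rfl
      exact add_nonneg h2 (mul_nonneg hs.le h3)
  · have h1 := key 0 (-V) 0 (by simpa using fun _ _ _ => hbound) fun s _ hs1 t i j => ?_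
    · rw [neg_zero, zero_add, show ((0, -V) : (Fin m → ℝ) × MatFam m n) = -(0, V) by simp,
        map_neg, pairing_apply] at h1
      simp only [dotProduct_zero, zero_add] at h1
      linarith
    · have := mul_nonneg (sub_nonneg.2 hs1) (hV t i j)
      simp only [Pi.add_apply, Pi.smul_apply, Pi.neg_apply, smul_eq_mul, Matrix.add_apply,
        Matrix.smul_apply, Matrix.neg_apply]
      linarith

/-- The conditions of the sweep `z, y, z` amount to one condition for the pair `(y, z)` with the
proximal term `sweepTerm`. -/
theorem sweep_condition (hm : 0 < m) {a : ZFam n} {D : MatFam m n} {β : ℝ} (hβ : 0 < β)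
    {x L : (Fin m → ℝ) × MatFam m n} {y y' : YFam N m} {zt z' : ZFam n}
    (h1 : ∀ dz, linearCost a ((0 : YFam N m), dz)
      + pairing (L + β • (x + couplingMap (y, zt) - (0, D))) (couplingMap (0, dz)) = 0)
    (h2 : ∀ dy, linearCost a (dy, (0 : ZFam n))
      + pairing (L + β • (x + couplingMap (y', zt) - (0, D))) (couplingMap (dy, 0)) = 0)
    (h3 : ∀ dz, linearCost a ((0 : YFam N m), dz)
      + pairing (L + β • (x + couplingMap (y', z') - (0, D))) (couplingMap (0, dz)) = 0)
    (z : ZFam n) (d : YFam N m × ZFam n) :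
    linearCost a d + pairing (L + β • (x + couplingMap (y', z') - (0, D))) (couplingMap d)
      + β * sweepTerm ((y', z') - (y, z)) d = 0 := by
  have hm' : (m : ℝ) ≠ 0 := by exact_mod_cast hm.ne'
  set W := L + β • (x + couplingMap (y', z') - (0, D)) with hW
  have e2 : L + β • (x + couplingMap (y', zt) - (0, D)) = W + β • couplingMap (0, zt - z') := by
    have : ((y', zt) : YFam N m × ZFam n) = (y', z') + (0, zt - z') := by simp
    rw [hW, this, map_add, add_assoc, ← smul_add]
    congr 2; abel
  have e1 : L + β • (x + couplingMap (y, zt) - (0, D)) = W + β • couplingMap (y - y', zt - z') := by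
    have : ((y, zt) : YFam N m × ZFam n) = (y', z') + (y - y', zt - z') := by simp
    rw [hW, this, map_add, add_assoc, ← smul_add]
    congr 2; abel
  -- Comparing the two `z`-steps shows that `zt - z'` is constant on each block, equal to
  -- `(∑ᵢ (y' - y)ᵢ) / m`. It suffices to test with constant vectors.
  have k1 := h1 fun t _ => (∑ i, d.1 t i) / m
  have k3 := h3 fun t _ => (∑ i, d.1 t i) / m
  have k2 := h2 d.1
  have k3' := h3 d.2
  rw [e1, map_add, map_smul, LinearMap.add_apply, LinearMap.smul_apply, smul_eq_mul] at k1
  rw [e2, map_add, map_smul, LinearMap.add_apply, LinearMap.smul_apply, smul_eq_mul] at k2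
  have k4 : β * pairing (couplingMap (y - y', zt - z'))
      (couplingMap (0, fun t (_ : Fin (n t)) => (∑ i, d.1 t i) / m)) = 0 := by linarith
  have k5 := (mul_eq_zero.1 k4).resolve_left hβ.ne'
  have k6 : pairing (couplingMap (0, zt - z')) (couplingMap (d.1, (0 : ZFam n)))
      = sweepTerm ((y', z') - (y, z)) d := by
    rw [pairing_couplingMap] at k5 ⊢
    rw [sweepTerm_apply]
    simp only [Pi.zero_apply, Finset.sum_const_zero, dotProduct_zero, zero_dotProduct, mul_zero,
      zero_add, add_zero, Prod.fst_sub] at k5 ⊢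
    rw [← sub_eq_zero, ← Finset.sum_sub_distrib, ← k5]
    refine Finset.sum_congr rfl fun t _ => ?_
    simp only [dotProduct, Finset.sum_const, Finset.card_univ, Fintype.card_fin, nsmul_eq_mul,
      ← Finset.sum_mul, Pi.sub_apply, Finset.sum_sub_distrib]
    field_simp
    ring
  have hd : d = (d.1, (0 : ZFam n)) + ((0 : YFam N m), d.2) := by simp
  rw [k6] at k2
  have e3 : linearCost a d + pairing W (couplingMap d)
      = (linearCost a (d.1, (0 : ZFam n)) + pairing W (couplingMap (d.1, 0)))
        + (linearCost a ((0 : YFam N m), d.2) + pairing W (couplingMap (0, d.2))) := by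
    conv_lhs => rw [hd]
    simp only [map_add]
    ring
  rw [e3]
  linarith

/-- The symmetric Gauss-Seidel ADMM is a semi-proximal ADMM for `dualSplit`. -/
theorem IsSGSADMM.isADMM (hm : 0 < m) (hn : ∀ t, 0 < n t) {a : ZFam n} {D : MatFam m n}
    {β τ : ℝ} (hβ : 0 < β) {u : ℕ → Fin m → ℝ} {V : ℕ → MatFam m n} {y : ℕ → YFam N m}
    {ztil z : ℕ → ZFam n} {lam : ℕ → Fin m → ℝ} {Lam : ℕ → MatFam m n}
    (h : IsSGSADMM a D β τ u V y ztil z lam Lam) :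
    (dualSplit hm hn a D).IsADMM β τ (fun k => (-u k, V k)) (fun k => (y k, z k))
      (fun k => (lam k, Lam k)) where
  step_x k := optimalityRel_of_isMinOn hm (h.step1 k)
  step_y k d := by
    have hV := (optimalityRel_of_isMinOn hm (h.step1 k)).2.2.1
    refine sweep_condition hm hβ (zt := ztil (k + 1)) (fun dz => ?_) (fun dy => ?_) (fun dz => ?_)
      (z k) d
    · refine smoothPart_stationary fun s => ?_
      have h1 := h.step2a k (Set.mem_univ (ztil (k + 1) + s • dz))
      simp only [Set.mem_ofPred_eq, augLagrangian_of_nonneg hm a D β _ hV,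
        EReal.coe_le_coe_iff, add_le_add_iff_left] at h1
      simpa using h1
    · refine smoothPart_stationary fun s => ?_
      have h1 := h.step2b k (Set.mem_univ (y (k + 1) + s • dy))
      simp only [Set.mem_ofPred_eq, augLagrangian_of_nonneg hm a D β _ hV,
        EReal.coe_le_coe_iff, add_le_add_iff_left] at h1
      simpa using h1
    · refine smoothPart_stationary fun s => ?_
      have h1 := h.step2c k (Set.mem_univ (z (k + 1) + s • dz))
      simp only [Set.mem_ofPred_eq, augLagrangian_of_nonneg hm a D β _ hV,
        EReal.coe_le_coe_iff, add_le_add_iff_left] at h1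
      simpa using h1
  step_L k := by
    have h1 : (dualSplit hm hn a D).res (-u (k + 1), V (k + 1)) (y (k + 1), z (k + 1)) = _ :=
      residual_eq D _ _ _ _
    rw [h1, h.step3_lam]
    ext1
    · rfl
    · funext t
      exact h.step3_Lam k t

/-! ### Karush-Kuhn-Tucker points are optimal -/

theorem mem_primalConstraints_iff {a : ZFam n} {L : (Fin m → ℝ) × MatFam m n} :
    L ∈ primalConstraints a ↔ ∀ w, linearCost a w + pairing L (couplingMap w) = 0 := by
  constructor
  · intro h w
    have h1 := linearCost_add_pairing a L.1 L.2 w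
    rw [h1]
    simp [fun t => (h t).1, fun t => (h t).2]
  · intro h
    have h1 := h (fun t => L.1 - (L.2 t).mulVec 1, fun t => a t - (L.2 t).transpose.mulVec 1)
    rw [show L = (L.1, L.2) from rfl, linearCost_add_pairing] at h1
    have n1 : ∀ t ∈ Finset.univ, 0 ≤ (L.1 - (L.2 t).mulVec 1) ⬝ᵥ (L.1 - (L.2 t).mulVec 1) :=
      fun t _ => Finset.sum_nonneg fun _ _ => mul_self_nonneg _
    have n2 : ∀ t ∈ Finset.univ, 0 ≤ (a t - (L.2 t).transpose.mulVec 1) ⬝ᵥ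
        (a t - (L.2 t).transpose.mulVec 1) :=
      fun t _ => Finset.sum_nonneg fun _ _ => mul_self_nonneg _
    have s1 := Finset.sum_nonneg n1
    have s2 := Finset.sum_nonneg n2
    intro t
    constructor
    · have := (Finset.sum_eq_zero_iff_of_nonneg n1).1 (by linarith) t (Finset.mem_univ t)
      exact (sub_eq_zero.1 (dotProduct_self_eq_zero.1 this)).symm
    · have := (Finset.sum_eq_zero_iff_of_nonneg n2).1 (by linarith) t (Finset.mem_univ t)
      exact (sub_eq_zero.1 (dotProduct_self_eq_zero.1 this)).symm

theorem mem_dualConstraints_iff {D V : MatFam m n} {u : Fin m → ℝ} {y : YFam N m} {z : ZFam n} :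
    (u, V, y, z) ∈ dualConstraints D ↔ (-u, V) + couplingMap (y, z) = ((0 : Fin m → ℝ), D) := by
  rw [← sub_eq_zero, residual_eq]
  exact Prod.mk_eq_zero.symm

theorem dotProduct_le_iSup {w : Fin m → ℝ} (hw : w ∈ stdSimplex ℝ (Fin m)) (u : Fin m → ℝ) :
    w ⬝ᵥ u ≤ ⨆ i, u i := by
  have h := le_dotProduct_of_mem_stdSimplex (x := -u) (c := -⨆ i, u i) hw
    fun i => neg_le_neg (le_ciSup (Finite.bddAbove_range u) i)
  rw [dotProduct_neg] at h
  linarith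

theorem isDualOptimal_of_isKKT (hm : 0 < m) (hn : ∀ t, 0 < n t) {a : ZFam n} {D V : MatFam m n}
    {u : Fin m → ℝ} {y : YFam N m} {z : ZFam n} {L : (Fin m → ℝ) × MatFam m n}
    (h : (dualSplit hm hn a D).IsKKT (-u, V) (y, z) L) : IsDualOptimal a D u V y z := by
  have : Nonempty (Fin m) := ⟨⟨0, hm⟩⟩
  obtain ⟨⟨h1, h2, h3, h4, h5⟩, hlin, hfeas⟩ := h
  change ∀ w, linearCost a w + pairing L (couplingMap w) = 0 at hlin
  change (-u, V) + couplingMap (y, z) = ((0 : Fin m → ℝ), D) at hfeas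
  -- On the feasible set the linear cost is an affine function of `(u, V)`.
  have value : ∀ (u' : Fin m → ℝ) (V' : MatFam m n) (w : YFam N m × ZFam n),
      (-u', V') + couplingMap w = ((0 : Fin m → ℝ), D) →
      linearCost a w = - L.1 ⬝ᵥ u' + ∑ t, frobInner (L.2 t) (V' t) - pairing L (0, D) := by
    intro u' V' w hw
    have e1 := hlin w
    rw [← hw, map_add]
    simp only [pairing_apply L (-u', V'), dotProduct_neg, neg_dotProduct] at e1 ⊢
    linarith
  refine ⟨mem_dualConstraints_iff.2 hfeas, ?_, ?_⟩
  · simp only [dualObjective_of_nonneg hm a u h3 y z]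
    exact EReal.coe_lt_top _
  · rintro ⟨u', V', y', z'⟩ hq
    rw [mem_dualConstraints_iff] at hq
    simp only [Set.mem_ofPred_eq]
    by_cases hV' : ∀ t i j, 0 ≤ V' t i j
    · rw [dualObjective_of_nonneg hm a u h3 y z, dualObjective_of_nonneg hm a u' hV' y' z',
        EReal.coe_le_coe_iff, value u V _ hfeas, value u' V' _ hq]
      have b1 := dotProduct_le_iSup h1 u'
      have b2 : 0 ≤ ∑ t, frobInner (L.2 t) (V' t) :=
        Finset.sum_nonneg fun t _ => frobInner_nonneg (h4 t) (hV' t)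
      have b3 : ⨆ i, u i ≤ L.1 ⬝ᵥ u := ciSup_le fun i => by
        have := h2 i
        simp only [dotProduct_neg, Pi.neg_apply] at this
        linarith
      simp only [neg_dotProduct]
      linarith
    · rw [dualObjective_of_not_nonneg hm a u' hV']
      exact le_top

theorem primalObjective_of_mem (D : MatFam m n) {L : (Fin m → ℝ) × MatFam m n}
    (h1 : L.1 ∈ stdSimplex ℝ (Fin m)) (h2 : ∀ t i j, 0 ≤ L.2 t i j) :
    primalObjective D L = ((pairing (0, D) L : ℝ) : EReal) := by
  rw [primalObjective, sum_indicatorFn_of_nonneg h2, indicatorFn, if_pos h1, pairing_apply]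
  simp

theorem isPrimalOptimal_of_isKKT (hm : 0 < m) (hn : ∀ t, 0 < n t) {a : ZFam n} {D : MatFam m n}
    {x : (Fin m → ℝ) × MatFam m n} {w : YFam N m × ZFam n} {lam : Fin m → ℝ} {Lam : MatFam m n}
    (h : (dualSplit hm hn a D).IsKKT x w (lam, Lam)) : IsPrimalOptimal a D lam Lam := by
  obtain ⟨⟨h1, h2, h3, h4, h5⟩, hlin, hfeas⟩ := h
  change ∀ w, linearCost a w + pairing (lam, Lam) (couplingMap w) = 0 at hlin
  change x + couplingMap w = ((0 : Fin m → ℝ), D) at hfeas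
  -- On the feasible set the transport cost is, up to a constant, the pairing with `x`.
  have value : ∀ L : (Fin m → ℝ) × MatFam m n,
      (∀ w, linearCost a w + pairing L (couplingMap w) = 0) →
      pairing (0, D) L = L.1 ⬝ᵥ x.1 + ∑ t, frobInner (L.2 t) (x.2 t) - linearCost a w := by
    intro L hL
    have e1 := hL w
    rw [pairing_symm, ← hfeas, map_add, pairing_apply L x]
    linarith
  refine ⟨mem_primalConstraints_iff.2 hlin, ?_, ?_⟩
  · rw [primalObjective_of_mem D h1 h4]
    exact EReal.coe_lt_top _
  · intro L hL
    have hL' := mem_primalConstraints_iff.1 hL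
    simp only [Set.mem_ofPred_eq]
    rw [primalObjective_of_mem D h1 h4]
    by_cases hΔ : L.1 ∈ stdSimplex ℝ (Fin m)
    · by_cases hpos : ∀ t i j, 0 ≤ L.2 t i j
      · rw [primalObjective_of_mem D hΔ hpos, EReal.coe_le_coe_iff, value _ hlin, value _ hL']
        have b1 := le_dotProduct_of_mem_stdSimplex hΔ h2
        have b2 : 0 ≤ ∑ t, frobInner (L.2 t) (x.2 t) :=
          Finset.sum_nonneg fun t _ => frobInner_nonneg (hpos t) (h3 t)
        simp only at b1 h5 ⊢
        linarith
      · rw [primalObjective, sum_indicatorFn_of_not_nonneg hpos, indicatorFn, if_pos hΔ]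
        simp
    · have hne : ∑ t, indicatorFn (nonnegMatrices m (n t)) (L.2 t) ≠ ⊥ := by
        by_cases hpos : ∀ t i j, 0 ≤ L.2 t i j
        · simp [sum_indicatorFn_of_nonneg hpos]
        · simp [sum_indicatorFn_of_not_nonneg hpos]
      rw [primalObjective, indicatorFn, if_neg hΔ, EReal.top_add_of_ne_bot hne,
        EReal.top_add_coe]
      exact le_top

/-! ### Strong duality for the barycenter problem -/

/-- Pairs `(λ, Λ)` satisfying all the primal constraints except the coupling `Λ⁽ᵗ⁾ e = λ`. -/
def relaxedPlans (m : ℕ) (a : ZFam n) : Set ((Fin m → ℝ) × MatFam m n) :=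
  {L | L.1 ∈ stdSimplex ℝ (Fin m) ∧ (∀ t i j, 0 ≤ L.2 t i j) ∧
    ∀ t, (L.2 t).transpose.mulVec 1 = a t}

theorem isCompact_relaxedPlans (a : ZFam n) : IsCompact (relaxedPlans m a) := by
  have hbox : IsCompact (stdSimplex ℝ (Fin m) ×ˢ
      (Set.univ.pi fun t => Set.univ.pi fun _ => Set.univ.pi fun j => Set.Icc 0 (a t j) :
        Set (MatFam m n))) :=
    (isCompact_stdSimplex ℝ (Fin m)).prod (isCompact_univ_pi fun t => isCompact_univ_pi fun _ =>
      isCompact_univ_pi fun j => isCompact_Icc)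
  refine hbox.of_isClosed_subset ?_ ?_
  · have c1 := (isCompact_stdSimplex ℝ (Fin m)).isClosed.preimage
      (continuous_fst (X := Fin m → ℝ) (Y := MatFam m n))
    have c2 : IsClosed {L : (Fin m → ℝ) × MatFam m n | ∀ t i j, 0 ≤ L.2 t i j} := by
      simp only [Set.ofPred_forall]
      exact isClosed_iInter fun t => isClosed_iInter fun i => isClosed_iInter fun j =>
        isClosed_le continuous_const (by fun_prop)
    have c3 : IsClosed {L : (Fin m → ℝ) × MatFam m n |
        ∀ t, (L.2 t).transpose.mulVec 1 = a t} := by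
      simp only [Set.ofPred_forall]
      exact isClosed_iInter fun t => isClosed_eq (by fun_prop) continuous_const
    exact c1.inter (c2.inter c3)
  · rintro L ⟨h1, h2, h3⟩
    refine ⟨h1, fun t _ i _ j _ => ⟨h2 t i j, ?_⟩⟩
    rw [← h3 t]
    simp only [Matrix.mulVec, dotProduct, Matrix.transpose_apply, Pi.one_apply, mul_one]
    exact Finset.single_le_sum (f := fun i => L.2 t i j) (fun i _ => h2 t i j) (Finset.mem_univ i)

theorem convex_relaxedPlans (a : ZFam n) : Convex ℝ (relaxedPlans m a) := by
  rintro L ⟨h1, h2, h3⟩ L' ⟨h1', h2', h3'⟩ s s' hs hs' hss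
  refine ⟨convex_stdSimplex ℝ (Fin m) h1 h1' hs hs' hss, fun t i j => ?_, fun t => ?_⟩
  · exact add_nonneg (mul_nonneg hs (h2 t i j)) (mul_nonneg hs' (h2' t i j))
  · simp only [Prod.snd_add, Prod.smul_snd, Pi.add_apply, Pi.smul_apply, Matrix.transpose_add,
      Matrix.transpose_smul, Matrix.add_mulVec, Matrix.smul_mulVec, h3 t, h3' t]
    rw [← add_smul, hss, one_smul]

/-- The matrices which send the whole mass `a⁽ᵗ⁾ⱼ` of column `j` to the row `σ t j`. -/
def selectionPlan (a : ZFam n) (σ : (t : Fin N) → Fin (n t) → Fin m) : MatFam m n :=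
  fun t => Matrix.of fun i j => if i = σ t j then a t j else 0

theorem selectionPlan_mem {a : ZFam n} (ha : ∀ t j, 0 ≤ a t j)
    (σ : (t : Fin N) → Fin (n t) → Fin m) (i : Fin m) :
    ((Pi.single i 1 : Fin m → ℝ), selectionPlan a σ) ∈ relaxedPlans m a := by
  refine ⟨single_mem_stdSimplex ℝ i, fun t i' j => ?_, fun t => ?_⟩
  · simp only [selectionPlan, Matrix.of_apply]
    split_ifs
    exacts [ha t j, le_rfl]
  · funext j
    simp [selectionPlan, Matrix.mulVec, dotProduct]

theorem frobInner_selectionPlan (a : ZFam n) (σ : (t : Fin N) → Fin (n t) → Fin m) (t : Fin N)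
    (A : Matrix (Fin m) (Fin (n t)) ℝ) :
    frobInner (selectionPlan a σ t) A = ∑ j, a t j * A (σ t j) j := by
  rw [frobInner, Finset.sum_comm]
  simp [selectionPlan]

theorem linear_apply_eq_sum (g : YFam N m →ₗ[ℝ] ℝ) (ρ : YFam N m) :
    g ρ = ∑ t, (fun i => g (Pi.single t (Pi.single i 1))) ⬝ᵥ ρ t := by
  conv_lhs => rw [← Finset.univ_sum_single ρ, map_sum]
  refine Finset.sum_congr rfl fun t _ => ?_
  change (g ∘ₗ LinearMap.single ℝ (fun _ => Fin m → ℝ) t) (ρ t) = _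
  conv_lhs => rw [pi_eq_sum_univ' (ρ t), map_sum]
  simp only [map_smul, smul_eq_mul, dotProduct, mul_comm (ρ t _)]
  rfl

/-- Pairing with the dual slack `D + y eᵀ` (and with `-∑ₜ y⁽ᵗ⁾`) is the Lagrangian of the primal
problem in which only the coupling constraint is dualized. -/
theorem pairing_sub_couplingMap (D : MatFam m n) (L : (Fin m → ℝ) × MatFam m n) (y : YFam N m) :
    pairing L ((0, D) - couplingMap (y, 0))
      = pairing (0, D) L + ∑ t, y t ⬝ᵥ ((L.2 t).mulVec 1 - L.1) := by
  have h := linearCost_add_pairing (0 : ZFam n) L.1 L.2 (y, 0)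
  simp only [linearCost_apply, dotProduct_zero, Pi.zero_apply, Finset.sum_const_zero, zero_add,
    add_zero] at h
  rw [map_sub, h, pairing_symm, sub_eq_add_neg, ← Finset.sum_neg_distrib]
  congr 1
  refine Finset.sum_congr rfl fun t _ => ?_
  rw [← neg_dotProduct, neg_sub, dotProduct_comm]

/-- Separating the image of the relaxed plans from an unattainable point yields an approximate
multiplier for the coupling constraint. -/
theorem exists_approx_multiplier {a : ZFam n} {D : MatFam m n} {Ls : (Fin m → ℝ) × MatFam m n}
    (hLs : Ls ∈ relaxedPlans m a) (hc : ∀ t, (Ls.2 t).mulVec 1 = Ls.1)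
    (hmin : ∀ L ∈ relaxedPlans m a, (∀ t, (L.2 t).mulVec 1 = L.1) →
      pairing (0, D) Ls ≤ pairing (0, D) L) {ε : ℝ} (hε : 0 < ε) :
    ∃ y : YFam N m, ∀ L ∈ relaxedPlans m a,
      pairing (0, D) Ls - ε ≤ pairing L ((0, D) - couplingMap (y, 0)) := by
  let Φ : ((Fin m → ℝ) × MatFam m n) →ₗ[ℝ] YFam N m × ℝ :=
    { toFun := fun L => (fun t => (L.2 t).mulVec 1 - L.1, pairing (0, D) L)
      map_add' := fun L L' => by
        ext1
        · funext t
          simp only [Prod.snd_add, Prod.fst_add, Pi.add_apply, Matrix.add_mulVec]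
          abel
        · simp
      map_smul' := fun c L => by
        ext1
        · funext t
          simp [Matrix.smul_mulVec, smul_sub]
        · simp }
  have hΦ : Continuous Φ := LinearMap.continuous_of_finiteDimensional _
  set v := pairing (0, D) Ls with hv
  have hnot : ((0, v - ε) : YFam N m × ℝ) ∉ Φ '' relaxedPlans m a := by
    rintro ⟨L, hL, hLe⟩
    have e1 : (fun t => (L.2 t).mulVec 1 - L.1) = (0 : YFam N m) := congrArg Prod.fst hLe
    have e2 : pairing (0, D) L = v - ε := congrArg Prod.snd hLe
    have := hmin L hL fun t => sub_eq_zero.1 (congrFun e1 t)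
    linarith
  obtain ⟨f, s, hf1, hf2⟩ := geometric_hahn_banach_closed_point
    ((convex_relaxedPlans a).linear_image Φ) ((isCompact_relaxedPlans a).image hΦ).isClosed hnot
  set α := f (0, 1) with hα
  have hsplit : ∀ (ρ : YFam N m) (c : ℝ), f (ρ, c) = f (ρ, 0) + c * α := by
    intro ρ c
    have : ((ρ, c) : YFam N m × ℝ) = (ρ, 0) + c • (0, 1) := by simp
    rw [this, map_add, map_smul, smul_eq_mul]
  have hf0 : f ((0 : YFam N m), (0 : ℝ)) = 0 := map_zero f
  have hlt : ∀ L ∈ relaxedPlans m a,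
      f (fun t => (L.2 t).mulVec 1 - L.1, 0) + pairing (0, D) L * α < (v - ε) * α := by
    intro L hL
    have h1 := hf1 _ ⟨L, hL, rfl⟩
    have h2 : f (Φ L) = f (fun t => (L.2 t).mulVec 1 - L.1, 0) + pairing (0, D) L * α :=
      hsplit _ _
    rw [hsplit, hf0, zero_add] at hf2
    linarith
  -- Evaluating at the primal solution shows that the hyperplane is not vertical.
  have hα0 : α < 0 := by
    have h1 := hlt Ls hLs
    have h2 : (fun t => (Ls.2 t).mulVec 1 - Ls.1) = (0 : YFam N m) := by
      funext t; simp [hc t]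
    rw [h2, hf0, ← hv] at h1
    nlinarith
  let g : YFam N m →ₗ[ℝ] ℝ := α⁻¹ • (f.toLinearMap ∘ₗ LinearMap.inl ℝ (YFam N m) ℝ)
  refine ⟨fun t i => g (Pi.single t (Pi.single i 1)), fun L hL => ?_⟩
  have hg := linear_apply_eq_sum g fun t => (L.2 t).mulVec 1 - L.1
  have hg' : g (fun t => (L.2 t).mulVec 1 - L.1)
      = α⁻¹ * f (fun t => (L.2 t).mulVec 1 - L.1, 0) := rfl
  rw [pairing_sub_couplingMap, ← hg, hg']
  have h1 := hlt L hL
  by_contra hcon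
  rw [not_le] at hcon
  have h2 := mul_lt_mul_of_neg_right hcon hα0
  have h3 : α⁻¹ * f (fun t => (L.2 t).mulVec 1 - L.1, 0) * α
      = f (fun t => (L.2 t).mulVec 1 - L.1, 0) := by
    rw [mul_right_comm, inv_mul_cancel₀ hα0.ne, one_mul]
  rw [add_mul, h3] at h2
  linarith

/-- Shifting every `y⁽ᵗ⁾` by a constant does not change the Lagrangian on relaxed plans. -/
theorem pairing_shift {a : ZFam n} (ha : ∀ t, ∑ j, a t j = 1) {D : MatFam m n}
    {L : (Fin m → ℝ) × MatFam m n} (hL : L ∈ relaxedPlans m a) (y : YFam N m) (c : Fin N → ℝ) :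
    pairing L ((0, D) - couplingMap (fun t i => y t i - c t, 0))
      = pairing L ((0, D) - couplingMap (y, 0)) := by
  rw [pairing_sub_couplingMap, pairing_sub_couplingMap]
  congr 1
  refine Finset.sum_congr rfl fun t _ => ?_
  have h1 : ∑ i, ((L.2 t).mulVec 1 - L.1) i = 0 := by
    have h2 : ∑ i, (L.2 t).mulVec 1 i = ∑ j, (L.2 t).transpose.mulVec 1 j := by
      simp only [Matrix.mulVec, dotProduct, Matrix.transpose_apply, Pi.one_apply, mul_one]
      exact Finset.sum_comm
    simp only [Pi.sub_apply, Finset.sum_sub_distrib]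
    rw [h2, hL.2.2 t, ha t, hL.1.2, sub_self]
  have h3 : (fun i => y t i - c t) = y t - c t • (1 : Fin m → ℝ) := by funext i; simp
  rw [h3, sub_dotProduct, smul_dotProduct, one_dotProduct, h1, smul_zero, sub_zero]

/-- An exact multiplier for the coupling constraint, obtained as a limit of approximate ones. -/
theorem exists_multiplier (hm : 0 < m) {a : ZFam n} (ha : ∀ t j, 0 ≤ a t j)
    (ha1 : ∀ t, ∑ j, a t j = 1) {D : MatFam m n} {Ls : (Fin m → ℝ) × MatFam m n}
    (hLs : Ls ∈ relaxedPlans m a) (hc : ∀ t, (Ls.2 t).mulVec 1 = Ls.1)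
    (hmin : ∀ L ∈ relaxedPlans m a, (∀ t, (L.2 t).mulVec 1 = L.1) →
      pairing (0, D) Ls ≤ pairing (0, D) L) :
    ∃ y : YFam N m, ∀ L ∈ relaxedPlans m a,
      pairing (0, D) Ls ≤ pairing L ((0, D) - couplingMap (y, 0)) := by
  have : Nonempty (Fin m) := ⟨⟨0, hm⟩⟩
  have hcont : Continuous fun L : (Fin m → ℝ) × MatFam m n => pairing (0, D) L :=
    LinearMap.continuous_of_finiteDimensional _
  obtain ⟨R, hR⟩ := (isCompact_relaxedPlans (m := m) a).bddAbove_image hcont.continuousOn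
  set v := pairing (0, D) Ls with hv
  -- Normalized approximate multipliers, with `min y⁽ᵗ⁾ = 0`, lie in a fixed box.
  have hk : ∀ k : ℕ, ∃ y : YFam N m,
      y ∈ (Set.univ.pi fun _ => Set.univ.pi fun _ => Set.Icc 0 (R - v + 1) : Set (YFam N m)) ∧
      ∀ L ∈ relaxedPlans m a,
        v - 1 / ((k : ℝ) + 1) ≤ pairing L ((0, D) - couplingMap (y, 0)) := by
    intro k
    have hpos : (0 : ℝ) < 1 / ((k : ℝ) + 1) := by positivity
    obtain ⟨y, hy⟩ := exists_approx_multiplier hLs hc hmin hpos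
    choose i hi using fun t => exists_eq_ciInf_of_finite (f := y t)
    have hmin' : ∀ t i', y t (i t) ≤ y t i' := fun t i' => by
      rw [hi]; exact ciInf_le (Finite.bddBelow_range _) i'
    have hy' : ∀ L ∈ relaxedPlans m a, v - 1 / ((k : ℝ) + 1)
        ≤ pairing L ((0, D) - couplingMap (fun t i' => y t i' - y t (i t), 0)) := fun L hL => by
      rw [pairing_shift ha1 hL y fun t => y t (i t)]
      exact hy L hL
    refine ⟨fun t i' => y t i' - y t (i t), fun t _ i' _ => ⟨sub_nonneg.2 (hmin' t i'), ?_⟩, hy'⟩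
    -- Test with the plan that moves all mass to the minimizing rows while `λ = e_{i'}`.
    have hmem := selectionPlan_mem ha (fun t (_ : Fin (n t)) => i t) i'
    have h1 := hy' _ hmem
    rw [pairing_sub_couplingMap] at h1
    have h2 := hR (Set.mem_image_of_mem _ hmem)
    have h3 : ∀ t, (selectionPlan a (fun t (_ : Fin (n t)) => i t) t).mulVec 1
        = Pi.single (i t) 1 := by
      intro t
      funext i''
      by_cases h : i'' = i t
      · simp [selectionPlan, Matrix.mulVec, dotProduct, h, ha1 t]
      · simp [selectionPlan, Matrix.mulVec, dotProduct, h]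
    simp only [h3, dotProduct_sub, dotProduct_single, mul_one, sub_self, zero_sub,
      Finset.sum_neg_distrib] at h1
    have h4 : y t i' - y t (i t) ≤ ∑ t, (y t i' - y t (i t)) :=
      Finset.single_le_sum (f := fun t => y t i' - y t (i t))
        (fun t _ => sub_nonneg.2 (hmin' t i')) (Finset.mem_univ t)
    have h5 : 1 / ((k : ℝ) + 1) ≤ 1 := by
      rw [div_le_one (by positivity)]
      have : (0 : ℝ) ≤ k := k.cast_nonneg
      linarith
    linarith
  choose y hybox hy using hk
  obtain ⟨ys, -, φ, hφ, hlim⟩ := (isCompact_univ_pi fun _ => isCompact_univ_pi fun _ =>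
    isCompact_Icc : IsCompact (Set.univ.pi fun _ => Set.univ.pi fun _ => Set.Icc 0 (R - v + 1) :
      Set (YFam N m))).tendsto_subseq hybox
  refine ⟨ys, fun L hL => ?_⟩
  have hc' : Continuous fun y : YFam N m => pairing L ((0, D) - couplingMap (y, 0)) := by
    simp only [pairing_sub_couplingMap, dotProduct]
    fun_prop
  have h1 : Tendsto (fun j => pairing L ((0, D) - couplingMap (y (φ j), 0))) atTop
      (𝓝 (pairing L ((0, D) - couplingMap (ys, 0)))) := (hc'.tendsto ys).comp hlim
  have h2 : Tendsto (fun j => v - 1 / ((φ j : ℝ) + 1)) atTop (𝓝 v) := by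
    have := (tendsto_one_div_add_atTop_nhds_zero_nat (𝕜 := ℝ)).comp hφ.tendsto_atTop
    simpa using this.const_sub v
  exact le_of_tendsto_of_tendsto' h2 h1 fun j => hy (φ j) L hL

theorem exists_primal_minimizer (hm : 0 < m) {a : ZFam n} (ha : ∀ t j, 0 ≤ a t j)
    (ha1 : ∀ t, ∑ j, a t j = 1) (D : MatFam m n) :
    ∃ Ls ∈ relaxedPlans m a, (∀ t, (Ls.2 t).mulVec 1 = Ls.1) ∧
      ∀ L ∈ relaxedPlans m a, (∀ t, (L.2 t).mulVec 1 = L.1) →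
        pairing (0, D) Ls ≤ pairing (0, D) L := by
  have hcont : Continuous fun L : (Fin m → ℝ) × MatFam m n => pairing (0, D) L :=
    LinearMap.continuous_of_finiteDimensional _
  have hclosed : IsClosed {L : (Fin m → ℝ) × MatFam m n | ∀ t, (L.2 t).mulVec 1 = L.1} := by
    simp only [Set.ofPred_forall]
    exact isClosed_iInter fun t => isClosed_eq (by fun_prop) (by fun_prop)
  have hne : (relaxedPlans m a ∩
      {L : (Fin m → ℝ) × MatFam m n | ∀ t, (L.2 t).mulVec 1 = L.1}).Nonempty := by
    refine ⟨_, selectionPlan_mem ha (fun _ _ => ⟨0, hm⟩) ⟨0, hm⟩, fun t => ?_⟩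
    funext i
    by_cases h : i = ⟨0, hm⟩
    · simp [selectionPlan, Matrix.mulVec, dotProduct, h, ha1 t]
    · simp [selectionPlan, Matrix.mulVec, dotProduct, h]
  obtain ⟨Ls, ⟨h1, h2⟩, h3⟩ := ((isCompact_relaxedPlans a).inter_right hclosed).exists_isMinOn hne
    hcont.continuousOn
  exact ⟨Ls, h1, h2, fun L hL hL' => h3 ⟨hL, hL'⟩⟩

/-- The optimality system of the barycenter problem is solvable. -/
theorem exists_isKKT (hm : 0 < m) (hn : ∀ t, 0 < n t) {a : ZFam n} (ha : ∀ t j, 0 ≤ a t j)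
    (ha1 : ∀ t, ∑ j, a t j = 1) (D : MatFam m n) :
    ∃ x w L, (dualSplit hm hn a D).IsKKT x w L := by
  have : Nonempty (Fin m) := ⟨⟨0, hm⟩⟩
  obtain ⟨Ls, hLs, hc, hmin⟩ := exists_primal_minimizer hm ha ha1 D
  obtain ⟨y, hy⟩ := exists_multiplier hm ha ha1 hLs hc hmin
  -- The best `z` for given `y`, attained in row `σ t j`.
  choose σ hσ using fun t j => exists_eq_ciSup_of_finite (f := fun i => -D t i j - y t i)
  have hσ' : ∀ t i j, -D t i j - y t i ≤ -D t (σ t j) j - y t (σ t j) := fun t i j => by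
    have h1 := le_ciSup (Finite.bddAbove_range fun i => -D t i j - y t i) i
    have h2 := hσ t j
    linarith
  let z : ZFam n := fun t j => -D t (σ t j) j - y t (σ t j)
  set x : (Fin m → ℝ) × MatFam m n := (0, D) - couplingMap (y, z) with hx
  have hx2 : ∀ t i j, x.2 t i j = D t i j + y t i + z t j := fun t i j => by
    simp [hx, couplingMap_apply]
    ring
  have hxpos : ∀ t i j, 0 ≤ x.2 t i j := fun t i j => by
    rw [hx2]
    have := hσ' t i j
    simp only [z]
    linarith
  have hlin : ∀ w, linearCost a w + pairing Ls (couplingMap w) = 0 :=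
    mem_primalConstraints_iff.1 fun t => ⟨hc t, hLs.2.2 t⟩
  obtain ⟨i₀, hi₀⟩ := exists_eq_ciInf_of_finite (f := x.1)
  have hmin₀ : ∀ i, x.1 i₀ ≤ x.1 i := fun i => by
    rw [hi₀]; exact ciInf_le (Finite.bddBelow_range _) i
  have hmem := selectionPlan_mem ha σ i₀
  -- Testing the multiplier with the plan supported where `V` vanishes and with `λ` at a maximal
  -- entry of `u` yields complementary slackness.
  have key : Ls.1 ⬝ᵥ x.1 + ∑ t, frobInner (Ls.2 t) (x.2 t) ≤ x.1 i₀ := by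
    have h1 := hy _ hmem
    have e0 : (0, D) - couplingMap (y, 0) = x + couplingMap ((0 : YFam N m), z) := by
      have : ((y, z) : YFam N m × ZFam n) = (y, 0) + (0, z) := by simp
      rw [hx, this, map_add]; abel
    have e1 : linearCost a ((0 : YFam N m), z)
        + pairing (Pi.single i₀ 1, selectionPlan a σ) (couplingMap (0, z)) = 0 := by
      rw [linearCost_add_pairing]
      simp [fun t => hmem.2.2 t]
    have e2 : pairing (Pi.single i₀ 1, selectionPlan a σ) x = x.1 i₀ := by
      rw [pairing_apply]
      simp only [frobInner_selectionPlan, single_dotProduct, one_mul]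
      have : ∀ t j, x.2 t (σ t j) j = 0 := fun t j => by rw [hx2]; simp only [z]; ring
      simp [this]
    have e3 : pairing (0, D) Ls = pairing Ls x - linearCost a (y, z) := by
      have h2 := hlin (y, z)
      have h3 : ((0, D) : (Fin m → ℝ) × MatFam m n) = x + couplingMap (y, z) := by
        rw [hx]; abel
      rw [pairing_symm, h3, map_add]
      linarith
    have e4 : linearCost a ((0 : YFam N m), z) = linearCost a (y, z) := rfl
    rw [e0, map_add, e2, e3, pairing_apply] at h1
    linarith
  have hLx : 0 ≤ ∑ t, frobInner (Ls.2 t) (x.2 t) :=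
    Finset.sum_nonneg fun t _ => frobInner_nonneg (hLs.2.1 t) (hxpos t)
  have hge := le_dotProduct_of_mem_stdSimplex hLs.1 hmin₀
  refine ⟨x, (y, z), Ls, ⟨hLs.1, fun i => ?_, hxpos, hLs.2.1, by linarith⟩, hlin, ?_⟩
  · linarith [hmin₀ i]
  · change x + couplingMap (y, z) = (0, D)
    rw [hx]; abel

end WassersteinBarycenter

/-! ### Convergence of the method -/

theorem theorem1 {N m : ℕ} (hm : 0 < m) {n : Fin N → ℕ}
    (a : ZFam n) (ha_nonneg : ∀ t j, 0 ≤ a t j) (ha_sum : ∀ t, ∑ j, a t j = 1)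
    (D : MatFam m n)
    (β τ : ℝ) (hβ : 0 < β) (hτ : τ ∈ Set.Ioo (0 : ℝ) ((1 + Real.sqrt 5) / 2))
    (u : ℕ → Fin m → ℝ) (V : ℕ → MatFam m n) (y : ℕ → YFam N m) (ztil z : ℕ → ZFam n)
    (lam : ℕ → Fin m → ℝ) (Lam : ℕ → MatFam m n)
    (hseq : IsSGSADMM a D β τ u V y ztil z lam Lam) :
    (∃ (u' : Fin m → ℝ) (V' : MatFam m n) (y' : YFam N m) (z' : ZFam n),
      IsDualOptimal a D u' V' y' z' ∧
        Tendsto (fun k => (u k, V k, y k, z k)) atTop (𝓝 (u', V', y', z'))) ∧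
    (∃ (lam' : Fin m → ℝ) (Lam' : MatFam m n),
      IsPrimalOptimal a D lam' Lam' ∧
        Tendsto (fun k => (lam k, Lam k)) atTop (𝓝 (lam', Lam'))) := by
  have hn : ∀ t, 0 < n t := fun t => by
    -- A probability vector has at least one entry.
    by_contra h
    have h0 : IsEmpty (Fin (n t)) := by
      rw [Nat.eq_zero_of_not_pos h]; infer_instance
    have := ha_sum t
    simp at this
  obtain ⟨⟨x', V'⟩, ⟨y', z'⟩, ⟨lam', Lam'⟩, hK, hx, hw, hL⟩ :=
    (hseq.isADMM hm hn hβ).exists_tendsto hβ hτ (exists_isKKT hm hn ha_nonneg ha_sum D)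
  refine ⟨⟨-x', V', y', z', isDualOptimal_of_isKKT hm hn (L := (lam', Lam')) (by simpa using hK),
    ?_⟩, lam', Lam', isPrimalOptimal_of_isKKT hm hn hK, hL⟩
  have h1 : Tendsto u atTop (𝓝 (-x')) := by
    have := ((continuous_fst.tendsto _).comp hx).neg
    simpa [Function.comp_def] using this
  exact h1.prodMk_nhds (((continuous_snd.tendsto _).comp hx).prodMk_nhds hw)
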